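/- \textbf{Setting.} Let $G$ be a finite group with conjugacy classes $C_0,\dots,C_d$. For a class $C$ let $A_C$ be the $G\times G$ complex matrix with $(A_C)_{xy}=1$ if $yx^{-1}\in C$ and $0$ otherwise, and let $E_C^*$ be the diagonal matrix with $(E_C^*)_{xx}=1$ if $x\in C$ and $0$ otherwise; write $A_i=A_{C_i}$, $E_i^*=E_{C_i}^*$. The Terwilliger algebra $T(G)$ (of the group association scheme, with respect to the identity $e$) is the subalgebra of $\mathrm{Mat}_G(\mathbb C)$ generated by all $A_i$ and all $E_i^*$. It acts on column vectors in $\mathbb C^G$; the primary module is the submodule generated by the characteristic vector of $e$, and the primary component $V$ of $T(G)$ is the Wedderburn component belonging to the primary module, i.e. the sum of all left ideals of $T(G)$ isomorphic to it. A Camina group is a group $G$ in which every conjugacy class outside $G'$ is a coset of $G'$. \textbf{Theorem.} Let $p$ be a prime and $G$ a finite Camina $p$-group of nilpotency class $3$ with $|G:G'|=p^{2n}$, $|G':Z(G)|=p^n$ and $|Z(G)|=p^k$. Let $\zeta\in\mathbb C$ be a primitive $p$-th root of unity, let $z_1,\dots,z_k$ generate $Z(G)$, and let $g_1,\dots,g_n\in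 G'$ be such that $g_1Z(G),\dots,g_nZ(G)$ generate $G'/Z(G)$. For a class $C_i\subseteq G'\setminus Z(G)$ and a class $C_t\subseteq G\setminus G'$, and for $\alpha,\beta\in\{0,\dots,p-1\}^k$, put \[W_i(\alpha)=\frac1{p^k}\sum_{a\in\{0,\dots,p-1\}^k}\ \prod_{j=1}^k\zeta^{\alpha_ja_j}\bigl(E_i^*A_{\{z_j\}}E_i^*\bigr)^{a_j},\qquad X_t(\beta)=\frac1{p^k}\sum_{a\in\{0,\dots,p-1\}^k}\ \prod_{j=1}^k\zeta^{\beta_ja_j}\bigl(E_t^*A_{\{z_j\}}E_t^*\bigr)^{a_j},\] and for a class $C_s\subseteq G\setminus G'$ and $\gamma\in\{0,\dots,p-1\}^n$ put \[Y_s(\gamma)=\frac1{p^{n+k}}\Bigl(\sum_{z\in Z(G)}E_s^*A_{\{z\}}E_s^*+\sum_{0\ne a\in\{0,\dots,p-1\}^n}p^k\prod_{j=1}^n\frac{\zeta^{\gamma_ja_j}}{p^{a_jk}}\bigl(E_s^*A_{g_jZ(G)}E_s^*\bigr)^{a_j}\Bigr),\] where $g_jZ(G)$ is the conjugacy class of $g_j$,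 and where the zeroth power of $E_i^*AE_i^*$ is $E_i^*$. Then for nonzero $\alpha,\beta,\gamma$ the elements $W_i(\alpha)$, $X_t(\beta)$, $Y_s(\gamma)$ are idempotents of $T(G)$, the two-sided ideals $\mathcal W_i(\alpha)$, $\mathcal X_t(\beta)$, $\mathcal Y_s(\gamma)$ of $T(G)$ that they generate are one-dimensional, and the Wedderburn decomposition of $T(G)$ into minimal two-sided ideals is the direct sum \[T(G)=V\oplus\bigoplus_{i}\bigoplus_{\alpha\neq0}\mathcal W_i(\alpha)\oplus\bigoplus_{t}\bigoplus_{\beta\ne0}\mathcal X_t(\beta)\oplus\bigoplus_{s}\bigoplus_{\gamma\neq0}\mathcal Y_s(\gamma),\] where $i$ runs over the $p^n-1$ classes contained in $G'\setminus Z(G)$ and $t,s$ each run over the $p^{2n}-1$ classes contained in $G\setminus G'$. There are $(p^n-1)(p^k-1)$ ideals $\mathcal W_i(\alpha)$, $(p^{2n}-1)(p^k-1)$ ideals $\mathcal X_t(\beta)$ and $(p^{2n}-1)(p^n-1)$ ideals $\mathcal Y_s(\gamma)$. -/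

import Mathlib

open Matrix

namespace CaminaTerwilliger

section Groups

variable (G : Type*) [Group G]

/-- A Camina group: every conjugacy class of `G` outside `G'` is a coset of `G'` in `G`. -/
def IsCamina : Prop :=
  ∀ c : ConjClasses G, c.carrier ⊆ (commutator G : Set G)ᶜ →
    ∃ g : G, c.carrier = {x : G | ∃ h ∈ commutator G, x = g * h}

/-- The conjugacy classes of `G` contained in `G' \ Z(G)`. -/
abbrev InnerClass : Type _ :=
  {c : ConjClasses G // c.carrier ⊆ (commutator G : Set G) \ (Subgroup.center G : Set G)}

/-- The conjugacy classes of `G` contained in `G \ G'`. -/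
abbrev OuterClass : Type _ :=
  {c : ConjClasses G // c.carrier ⊆ (commutator G : Set G)ᶜ}

/-- Vectors `(α₁, …, α_m)` with entries in `{0, …, p - 1}`, not all of them zero. -/
abbrev NonzeroVector (p m : ℕ) : Type :=
  {α : Fin m → Fin p // ∃ j, (α j : ℕ) ≠ 0}

end Groups

section Algebra

variable {G : Type*} [Group G] [Fintype G] [DecidableEq G]

open scoped Classical in
/-- The adjacency matrix of the relation `{(x, y) | y x⁻¹ ∈ c}` of the group association scheme,
where `c` is a conjugacy class. -/
noncomputable def adjMatrix (c : ConjClasses G) : Matrix G G ℂ :=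
  Matrix.of fun x y => if y * x⁻¹ ∈ c.carrier then 1 else 0

open scoped Classical in
/-- The dual idempotent (with respect to the identity element) of the class `c`: the diagonal
matrix whose `(x, x)` entry is `1` if `x ∈ c` and `0` otherwise. -/
noncomputable def dualIdempotent (c : ConjClasses G) : Matrix G G ℂ :=
  Matrix.diagonal fun x => if x ∈ c.carrier then 1 else 0

variable (G) in
/-- The Terwilliger algebra `T(G)` of the group association scheme of `G` with respect to the
identity element: the subalgebra of the full complex matrix algebra generated by all adjacency
matrices and all dual idempotents. -/
noncomputable def terwilligerAlgebra : Subalgebra ℂ (Matrix G G ℂ) :=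
  Algebra.adjoin ℂ (Set.range (adjMatrix (G := G)) ∪ Set.range (dualIdempotent (G := G)))

/-- The adjacency matrix `A_c` as an element of `T(G)`. -/
noncomputable def adjT (c : ConjClasses G) : terwilligerAlgebra G :=
  ⟨adjMatrix c, Algebra.subset_adjoin (Or.inl ⟨c, rfl⟩)⟩

/-- The dual idempotent `E_c^*` as an element of `T(G)`. -/
noncomputable def dualT (c : ConjClasses G) : terwilligerAlgebra G :=
  ⟨dualIdempotent c, Algebra.subset_adjoin (Or.inr ⟨c, rfl⟩)⟩

/-- `T(G)` acts on the standard module of column vectors by matrix-vector multiplication. -/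
theorem terwilligerAlgebra_smul_eq (t : terwilligerAlgebra G) (v : G → ℂ) :
    t • v = (t : Matrix G G ℂ) *ᵥ v := rfl

variable (G) in
/-- The primary module: the `T(G)`-submodule of the standard module `G → ℂ` generated by the
characteristic vector of the base point, the identity element. -/
noncomputable def primaryModule : Submodule (terwilligerAlgebra G) (G → ℂ) :=
  Submodule.span (terwilligerAlgebra G) {Pi.single (1 : G) (1 : ℂ)}

variable (G) in
/-- The primary component of `T(G)`: the Wedderburn component that belongs to the primary module,
that is, the sum of all left ideals isomorphic to the primary module. -/
noncomputable def primaryComponent : Ideal (terwilligerAlgebra G) :=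
  isotypicComponent (terwilligerAlgebra G) (terwilligerAlgebra G) (primaryModule G)

/-- `E_i^* A_c E_i^*`, the matrix that agrees with `A_c` in the `C_i, C_i` block and is zero
elsewhere. -/
noncomputable def blockAdj (i c : ConjClasses G) : terwilligerAlgebra G :=
  dualT i * adjT c * dualT i

/-- The power `(E_i^* A_c E_i^*) ^ a` in the corner algebra of matrices supported on the
`C_i, C_i` block; in particular the zeroth power is the identity `E_i^*` of that algebra. -/
noncomputable def blockPow (i c : ConjClasses G) (a : ℕ) : terwilligerAlgebra G :=
  if a = 0 then dualT i else blockAdj i c ^ a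

/-- The element
`p^{-k} ∑_{a ∈ {0,…,p-1}^k} ∏_j ζ^{α_j a_j} (E_i^* A_j E_i^*)^{a_j}`, with `A_j` the adjacency matrix
of the class of `z_j`. For `C_i ⊆ G' \ Z(G)` this is `W_i(α)`, and for `C_i ⊆ G \ G'` it is
`X_i(α)`. -/
noncomputable def centralElt (p : ℕ) {k : ℕ} (ζ : ℂ) (z : Fin k → G) (i : ConjClasses G)
    (α : Fin k → Fin p) : terwilligerAlgebra G :=
  ((1 : ℂ) / (p : ℂ) ^ k) • ∑ a : Fin k → Fin p,
    (List.ofFn fun j : Fin k =>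
      ζ ^ ((α j : ℕ) * (a j : ℕ)) • blockPow i (ConjClasses.mk (z j)) (a j)).prod

/-- `W_i(α)`, for a class `C_i ⊆ G' \ Z(G)`. -/
noncomputable def eltW (p : ℕ) {k : ℕ} (ζ : ℂ) (z : Fin k → G) (i : InnerClass G)
    (α : Fin k → Fin p) : terwilligerAlgebra G :=
  centralElt p ζ z i.1 α

/-- `X_t(β)`, for a class `C_t ⊆ G \ G'`. -/
noncomputable def eltX (p : ℕ) {k : ℕ} (ζ : ℂ) (z : Fin k → G) (t : OuterClass G)
    (β : Fin k → Fin p) : terwilligerAlgebra G :=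
  centralElt p ζ z t.1 β

open scoped Classical in
/-- `Y_s(γ)`, for a class `C_s ⊆ G \ G'`:
`p^{-(n+k)} (∑_{z ∈ Z(G)} E_s^* A_{z} E_s^* +
  ∑_{a ≠ 0} p^k ∏_j (ζ^{γ_j a_j} / p^{a_j k}) (E_s^* A_j E_s^*)^{a_j})`,
where `A_{z}` belongs to the class `{z}` and `A_j` to the class of `g_j` (which is `g_j Z(G)`). -/
noncomputable def eltY (p k : ℕ) {n : ℕ} (ζ : ℂ) (g : Fin n → G) (s : OuterClass G)
    (γ : Fin n → Fin p) : terwilligerAlgebra G :=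
  ((1 : ℂ) / (p : ℂ) ^ (n + k)) •
    ((∑ z : G with z ∈ Subgroup.center G, blockAdj s.1 (ConjClasses.mk z)) +
      ∑ a : Fin n → Fin p with ∃ j, (a j : ℕ) ≠ 0,
        ((p : ℂ) ^ k) • (List.ofFn fun j : Fin n =>
          (ζ ^ ((γ j : ℕ) * (a j : ℕ)) / (p : ℂ) ^ ((a j : ℕ) * k)) •
            blockPow s.1 (ConjClasses.mk (g j)) (a j)).prod)

/-- The two-sided ideal generated by an element. -/
def idealGen {R : Type*} [Ring R] (x : R) : Ideal R :=
  (TwoSidedIdeal.span {x}).asIdeal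

/-- Minimal (nonzero) two-sided ideals, the simple components in a Wedderburn decomposition. -/
def IsMinimalTwoSided {R : Type*} [Ring R] (I : Ideal R) : Prop :=
  I.IsTwoSided ∧ I ≠ ⊥ ∧ ∀ J : Ideal R, J.IsTwoSided → J ≤ I → J = ⊥ ∨ J = I

variable (G) in
/-- The index set of the Wedderburn decomposition. -/
inductive ComponentIndex (p n k : ℕ) : Type _
  | primary : ComponentIndex p n k
  | first (i : InnerClass G) (α : NonzeroVector p k) : ComponentIndex p n k
  | second (t : OuterClass G) (β : NonzeroVector p k) : ComponentIndex p n k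
  | third (s : OuterClass G) (γ : NonzeroVector p n) : ComponentIndex p n k

noncomputable instance (p n k : ℕ) : DecidableEq (ComponentIndex G p n k) :=
  Classical.decEq _

/-- The components `V`, `(W_i(α))`, `(X_t(β))` and `(Y_s(γ))` of `T(G)`. -/
noncomputable def component (p : ℕ) {n k : ℕ} (ζ : ℂ) (z : Fin k → G) (g : Fin n → G) :
    ComponentIndex G p n k → Ideal (terwilligerAlgebra G)
  | .primary => primaryComponent G
  | .first i α => idealGen (eltW p ζ z i α.1)
  | .second t β => idealGen (eltX p ζ z t β.1)
  | .third s γ => idealGen (eltY p k ζ g s γ.1)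

end Algebra

end CaminaTerwilliger

open CaminaTerwilliger

/-! Everything rests on the shape of the conjugacy classes: a central element is alone in its class,
the class of x ∈ G' \ Z(G) is xZ(G), and the class of x ∉ G' is xG'. The last is the Camina
hypothesis; the middle one is the deep point. Write γ₃ = [G', G]. Commutation induces an alternating
pairing β : G/G' × G/G' → G'/γ₃ with β(x, ·) onto for every x ≠ 0, and a pairing G'/γ₃ × G/G' → γ₃,
both over 𝔽_p and tied together by the Hall–Witt (Jacobi) identity. If the commutators of some u ∈
G' \ γ₃ did not fill γ₃, a functional killing them would give a nonzero scalar pairing with u in its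
left radical. A dimension count (`eq_zero_of_jacobi_pairing`) excludes this. It needs 2 dim(G'/γ₃) ≤
dim(G/G') (`two_mul_finrank_le_of_alternating`): otherwise the Pfaffian of the generic combination
of the coordinate forms of β has degree below its number of variables, so by Chevalley–Warning a
nontrivial zero. Hence [u, G] = γ₃, and then Z(G) = γ₃.

Now let N be Z(G) or G', f a nontrivial linear character of N, and c a class that is a union of
N-cosets. Consider the kernel f(yx⁻¹) on the block c × c. Multiplication by A_j convolves f with the
indicator of the class C_j. Inside N this gives a scalar; outside N the indicator is constant on
N-cosets and orthogonality of characters kills the result. So all of T(G) acts on the kernel by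
scalars from both sides (`IsKernelChar.isScalarIdempotent`), and the kernel divided by |N| is an
idempotent generating a one-dimensional ideal. The W and X are these idempotents for N = Z(G); the Y
are those for N = G' and characters trivial on Z(G).

The primary component is cut out by the average of the conjugation permutation matrices, a central
idempotent of T(G). Its matrices are constant on blocks, which makes it minimal. Finally, Fourier
inversion writes E_c^* for an inner class as the sum of all W(α), and for an outer class as the sum
of all X(β), with X(0) the sum of all Y(γ). The terms W(0) and Y(0) are constant on blocks and lie
in V, as do the E_c^* of central classes. Thus 1 lies in the sum of the components, and
orthogonality of the idempotents makes the sum direct. -/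

namespace CaminaTerwilliger

/-! ### Alternating forms over finite fields -/

section AlternatingForms

/-- Swapping the two indices pairs off cancelling terms of the double sum. The diagonal terms vanish
by `h0`, so characteristic 2 needs no exception. -/
theorem dotProduct_mulVec_self_eq_zero {R ι : Type*} [CommRing R] [Fintype ι] [DecidableEq ι]
    (A : Matrix ι ι R) (hA : ∀ i j, A i j + A j i = 0) (h0 : ∀ i, A i i = 0) (v : ι → R) :
    v ⬝ᵥ (A *ᵥ v) = 0 := by
  have h1 : v ⬝ᵥ (A *ᵥ v) = ∑ x : ι × ι, v x.1 * A x.1 x.2 * v x.2 := by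
    simp only [dotProduct, mulVec, Finset.mul_sum, Fintype.sum_prod_type, mul_assoc]
  rw [h1]
  refine Finset.sum_involution (fun x _ => x.swap) ?_ ?_ (fun _ _ => Finset.mem_univ _)
    (fun _ _ => Prod.swap_swap _)
  · rintro ⟨i, j⟩ -
    simp only [Prod.swap]
    linear_combination v i * v j * hA i j
  · rintro ⟨i, j⟩ - h h2
    simp only [Prod.swap, Prod.mk.injEq] at h2
    obtain ⟨rfl, -⟩ := h2
    simp [h0] at h

/-- The determinant of an alternating matrix over a field is a square. -/
theorem isSquare_det_of_alternating {K : Type*} [Field K] (n : ℕ) :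
    ∀ {ι : Type} [Fintype ι] [DecidableEq ι] (A : Matrix ι ι K),
      Fintype.card ι = n → (∀ v, v ⬝ᵥ (A *ᵥ v) = 0) → IsSquare A.det := by
  induction n using Nat.strong_induction_on with
  | _ n ih =>
    intro ι _ _ A hn hA
    have hdiag : ∀ i, A i i = 0 := fun i => by
      simpa [Matrix.mulVec_single] using hA (Pi.single i 1)
    have hskew : ∀ i j, A j i = - A i j := fun i j => by
      have h := hA (Pi.single i 1 + Pi.single j 1)
      simp [Matrix.mulVec_add, add_dotProduct, dotProduct_add, Matrix.mulVec_single, hdiag] at h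
      linear_combination h
    by_cases hzero : A = 0
    · subst hzero
      rcases isEmpty_or_nonempty ι with h | h
      · rw [Matrix.det_isEmpty]; exact IsSquare.one
      · rw [Matrix.det_zero]; exact IsSquare.zero
    -- A nonzero entry gives an invertible principal 2 × 2 block of determinant (A i j)². Its Schur
    -- complement is alternating and smaller, so the induction applies to it.
    obtain ⟨i, j, hij⟩ : ∃ i j, A i j ≠ 0 := by
      by_contra! h
      exact hzero (by ext i j; exact h i j)
    have hne : i ≠ j := by rintro rfl; exact hij (hdiag i)
    let P : ι → Prop := fun x => x = i ∨ x = j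
    let e : Fin 2 ≃ {x // P x} := Equiv.ofBijective ![⟨i, Or.inl rfl⟩, ⟨j, Or.inr rfl⟩] <| by
      constructor
      · intro a b
        fin_cases a <;> fin_cases b <;> simp [hne, hne.symm]
      · rintro ⟨x, rfl | rfl⟩
        · exact ⟨0, rfl⟩
        · exact ⟨1, rfl⟩
    have hdet : (A.toBlock P P).det = A i j * A i j := by
      rw [← Matrix.det_submatrix_equiv_self e, Matrix.det_fin_two]
      simp only [Matrix.submatrix_apply, Matrix.toBlock_apply]
      change A i i * A j j - A i j * A j i = _
      rw [hskew i j, hdiag i]; ring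
    have hunit : IsUnit (A.toBlock P P) := by
      rw [Matrix.isUnit_iff_isUnit_det, hdet]
      exact (mul_ne_zero hij hij).isUnit
    let := hunit.invertible
    rw [Matrix.det_toBlock A P, Matrix.det_fromBlocks₁₁, hdet]
    refine IsSquare.mul ⟨_, rfl⟩ (ih (Fintype.card {x // ¬ P x}) ?_ _ rfl ?_)
    · rw [← hn]
      exact Fintype.card_subtype_lt (x := i) (by simp [P])
    · intro v
      -- This u solves the first block row, so the quadratic form of A at (u, v) equals that of the
      -- Schur complement at v.
      set u : {x // P x} → K :=
        - ((⅟(A.toBlock P P)) *ᵥ (A.toBlock P (fun x => ¬ P x) *ᵥ v)) with hu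
      have key := hA (Sum.elim u v ∘ (Equiv.sumCompl P).symm)
      have hre : ∀ w : {x // P x} ⊕ {x // ¬ P x} → K,
          (w ∘ (Equiv.sumCompl P).symm) ⬝ᵥ (A *ᵥ (w ∘ (Equiv.sumCompl P).symm)) =
          w ⬝ᵥ ((fromBlocks (A.toBlock P P) (A.toBlock P fun x => ¬ P x)
            (A.toBlock (fun x => ¬ P x) P) (A.toBlock (fun x => ¬ P x) fun x => ¬ P x)) *ᵥ w) := by
        intro w
        have hB : A.submatrix (Equiv.sumCompl P) (Equiv.sumCompl P) =
            (fromBlocks (A.toBlock P P) (A.toBlock P fun x => ¬ P x)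
            (A.toBlock (fun x => ¬ P x) P) (A.toBlock (fun x => ¬ P x) fun x => ¬ P x)) := by
          ext (a | a) (b | b) <;> rfl
        rw [← hB, Matrix.submatrix_mulVec_equiv]
        simp only [dotProduct]
        rw [← Equiv.sum_comp (Equiv.sumCompl P)]
        simp
      rw [hre, Matrix.fromBlocks_mulVec] at key
      simp only [Sum.elim_comp_inl, Sum.elim_comp_inr] at key
      rw [sumElim_dotProduct_sumElim] at key
      have h1 : A.toBlock P P *ᵥ u + (A.toBlock P fun x => ¬ P x) *ᵥ v = 0 := by
        rw [hu, Matrix.mulVec_neg, Matrix.mulVec_mulVec, mul_invOf_self, Matrix.one_mulVec]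
        simp
      rw [h1, dotProduct_zero, zero_add] at key
      rw [← key, Matrix.sub_mulVec, hu]
      simp only [Matrix.mulVec_neg, ← Matrix.mulVec_mulVec]
      rw [neg_add_eq_sub]

/-- The determinant of an alternating matrix over an integrally closed domain is a square. -/
theorem isSquare_det_of_isIntegrallyClosed {R : Type*} [CommRing R] [IsDomain R]
    [IsIntegrallyClosed R] {m : ℕ} (A : Matrix (Fin m) (Fin m) R)
    (hA : ∀ i j, A i j + A j i = 0) (h0 : ∀ i, A i i = 0) : IsSquare A.det := by
  have hsq : IsSquare (algebraMap R (FractionRing R) A.det) := by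
    rw [RingHom.map_det]
    refine isSquare_det_of_alternating m _ (by simp) (dotProduct_mulVec_self_eq_zero _ ?_ ?_)
    · intro i j
      simp only [RingHom.mapMatrix_apply, Matrix.map_apply, ← map_add, hA, map_zero]
    · intro i
      simp only [RingHom.mapMatrix_apply, Matrix.map_apply, h0, map_zero]
  -- The square root found in the fraction field is integral, since its square lies in R; hence it
  -- lies in R.
  obtain ⟨s, hs⟩ := hsq
  obtain ⟨f, hf⟩ := IsIntegrallyClosed.exists_algebraMap_eq_of_isIntegral_pow
    (R := R) (x := s) (n := 2) (by norm_num) (by rw [sq, ← hs]; exact isIntegral_algebraMap)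
  refine ⟨f, IsFractionRing.injective R (FractionRing R) ?_⟩
  rw [hs, map_mul, hf]

open MvPolynomial in
theorem totalDegree_det_le {R σ : Type*} [CommRing R] {m : ℕ}
    (A : Matrix (Fin m) (Fin m) (MvPolynomial σ R)) (hA : ∀ i j, (A i j).totalDegree ≤ 1) :
    A.det.totalDegree ≤ m := by
  rw [Matrix.det_apply]
  refine (totalDegree_finsetSum _ _).trans (Finset.sup_le fun τ _ => ?_)
  refine (totalDegree_smul_le _ _).trans ((totalDegree_finsetProd _ _).trans ?_)
  exact (Finset.sum_le_card_nsmul _ _ 1 fun i _ => hA _ _).trans (by simp)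

open MvPolynomial in
/-- If every nonzero `x` makes `β x` surjective, then the target of an alternating bilinear map over
a prime field has at most half the dimension of the source. -/
theorem two_mul_finrank_le_of_alternating {p : ℕ} [Fact p.Prime] {V W : Type*}
    [AddCommGroup V] [AddCommGroup W] [Module (ZMod p) V] [Module (ZMod p) W]
    [FiniteDimensional (ZMod p) V] [FiniteDimensional (ZMod p) W] [Nontrivial V]
    (β : V →ₗ[ZMod p] V →ₗ[ZMod p] W) (hβ : ∀ x, β x x = 0)
    (hs : ∀ x, x ≠ 0 → Function.Surjective (β x)) :
    2 * Module.finrank (ZMod p) W ≤ Module.finrank (ZMod p) V := by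
  set m := Module.finrank (ZMod p) V with hm
  set w := Module.finrank (ZMod p) W with hw
  have hmpos : 0 < m := Module.finrank_pos
  let bV := Module.finBasis (ZMod p) V
  let bW := Module.finBasis (ZMod p) W
  let c : Fin m → Fin m → Fin w → ZMod p := fun i j l => bW.repr (β (bV i) (bV j)) l
  have hskew : ∀ x y, β x y + β y x = 0 := fun x y => by
    have h := hβ (x + y)
    simpa [hβ] using h
  -- The generic linear combination of the coordinate forms of β. Its determinant has degree at most
  -- m and is a square f², so f plays the role of the Pfaffian, with 2 deg f ≤ m.
  let M : Matrix (Fin m) (Fin m) (MvPolynomial (Fin w) (ZMod p)) :=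
    Matrix.of fun i j => ∑ l, C (c i j l) * X l
  have hMdeg : M.det.totalDegree ≤ m := by
    refine totalDegree_det_le M fun i j => ?_
    refine (totalDegree_finsetSum Finset.univ fun l => C (c i j l) * X l).trans
      (Finset.sup_le fun l _ => ?_)
    exact (totalDegree_mul _ _).trans (by rw [totalDegree_C, totalDegree_X])
  obtain ⟨f, hf⟩ : IsSquare M.det := by
    refine isSquare_det_of_isIntegrallyClosed M ?_ ?_
    · intro i j
      simp only [M, Matrix.of_apply, ← Finset.sum_add_distrib, ← add_mul, ← C_add]
      refine Finset.sum_eq_zero fun l _ => ?_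
      have : c i j l + c j i l = 0 := by
        simp only [c]
        rw [← Finsupp.add_apply, ← map_add, hskew]; simp
      rw [this, C_0, zero_mul]
    · intro i
      simp [M, c, hβ]
  by_contra! hlt
  have hfdeg : f.totalDegree < w := by
    by_cases hf0 : f = 0
    · subst hf0; simp; omega
    · have := totalDegree_mul_of_isDomain hf0 hf0
      rw [← hf] at this
      omega
  -- Chevalley–Warning: the number of zeros of f is divisible by p, and 0 is one of them, so there
  -- is another.
  have hdvd := char_dvd_card_solutions (K := ZMod p) p (f := f) (by simpa using hfdeg)
  have hf0 : eval (0 : Fin w → ZMod p) f = 0 := by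
    have h : eval (0 : Fin w → ZMod p) M.det = 0 := by
      rw [RingHom.map_det]
      have : (eval (0 : Fin w → ZMod p)).mapMatrix M = 0 := by
        ext i j
        simp [M]
      rw [this]
      have : Nonempty (Fin m) := ⟨⟨0, hmpos⟩⟩
      exact Matrix.det_zero
    rw [hf, map_mul] at h
    exact mul_self_eq_zero.mp h
  have : Nonempty {x : Fin w → ZMod p // eval x f = 0} := ⟨⟨0, hf0⟩⟩
  have hcard : 1 < Fintype.card {x : Fin w → ZMod p // eval x f = 0} :=
    lt_of_lt_of_le (Fact.out : p.Prime).one_lt (Nat.le_of_dvd Fintype.card_pos hdvd)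
  obtain ⟨⟨t, ht⟩, hne⟩ := Fintype.exists_ne_of_one_lt_card hcard ⟨0, hf0⟩
  have htne : t ≠ 0 := fun h => hne (Subtype.ext h)
  have hdet : ((eval t).mapMatrix M).det = 0 := by
    rw [← RingHom.map_det, hf, map_mul, ht, mul_zero]
  -- A left kernel vector of M(t) is a nonzero x whose β x has image in the kernel of the functional
  -- φ with coordinates t. Since φ ≠ 0, this contradicts surjectivity.
  obtain ⟨v, hv, hvM⟩ := Matrix.exists_vecMul_eq_zero_iff.mpr hdet
  let x : V := ∑ i, v i • bV i
  have hx : x ≠ 0 := by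
    intro h
    apply hv
    funext i
    exact (Fintype.linearIndependent_iff.mp bV.linearIndependent) v h i
  let φ : W →ₗ[ZMod p] ZMod p := bW.constr (ZMod p) t
  have hφ : ∀ u : W, φ u = ∑ l, bW.repr u l * t l := fun u => by
    simp [φ, Module.Basis.constr_apply_fintype, Module.Basis.equivFun_apply]
  have hφβ : φ ∘ₗ β x = 0 := by
    refine bV.ext fun j => ?_
    have := congrFun hvM j
    simp only [Matrix.vecMul, dotProduct, RingHom.mapMatrix_apply, Matrix.map_apply, M,
      Matrix.of_apply, map_sum, map_mul, eval_C, eval_X, Pi.zero_apply] at this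
    simp only [LinearMap.comp_apply, LinearMap.zero_apply, x, map_sum, map_smul,
      LinearMap.sum_apply, LinearMap.smul_apply, smul_eq_mul]
    simpa only [hφ] using this
  apply htne
  funext l
  obtain ⟨y, hy⟩ := hs x hx (bW l)
  have h1 : φ (bW l) = 0 := by
    rw [← hy]; exact LinearMap.congr_fun hφβ y
  simpa [φ] using h1

/-- Let `β` be an alternating bilinear map all of whose nonzero partial maps are onto, and let `τ`
be a nonzero pairing between its target and its source that satisfies the Jacobi identity with
`β`. Then `τ` is nondegenerate on the left. -/
theorem eq_zero_of_jacobi_pairing {p : ℕ} [Fact p.Prime] {V W : Type*}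
    [AddCommGroup V] [AddCommGroup W] [Module (ZMod p) V] [Module (ZMod p) W]
    [FiniteDimensional (ZMod p) V] [FiniteDimensional (ZMod p) W]
    (β : V →ₗ[ZMod p] V →ₗ[ZMod p] W) (hβ : ∀ x, β x x = 0)
    (hs : ∀ x, x ≠ 0 → Function.Surjective (β x))
    (τ : W →ₗ[ZMod p] V →ₗ[ZMod p] ZMod p) (hτ : τ ≠ 0)
    (hJ : ∀ x y z, τ (β x y) z + τ (β y z) x + τ (β z x) y = 0)
    (w : W) (hw : τ w = 0) : w = 0 := by
  have hskew : ∀ x y, β x y = - β y x := fun x y => by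
    have h := hβ (x + y)
    simp [hβ] at h
    exact eq_neg_of_add_eq_zero_left h
  set V₀ := LinearMap.ker τ.flip with hV₀
  set R := LinearMap.ker τ with hR
  have hV₀' : ∀ x, x ∈ V₀ ↔ ∀ u, τ u x = 0 := fun x => by
    rw [hV₀, LinearMap.mem_ker]
    exact ⟨fun h u => LinearMap.congr_fun h u, fun h => LinearMap.ext h⟩
  have hiso : ∀ x ∈ V₀, ∀ y ∈ V₀, β x y ∈ R := by
    intro x hx y hy
    rw [hR, LinearMap.mem_ker]
    ext z
    have := hJ x y z
    rw [(hV₀' x).1 hx, (hV₀' y).1 hy] at this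
    simpa using this
  obtain ⟨y₀, hy₀⟩ : ∃ y, y ∉ V₀ := by
    by_contra! h
    exact hτ (LinearMap.ext fun u => LinearMap.ext fun y => (hV₀' y).1 (h y) u)
  have : Nontrivial V := ⟨y₀, 0, fun h => hy₀ (h ▸ V₀.zero_mem)⟩
  have hCW := two_mul_finrank_le_of_alternating β hβ hs
  have hrk : Module.finrank (ZMod p) (LinearMap.range τ.flip) =
      Module.finrank (ZMod p) (LinearMap.range τ) := by
    have h : τ.flip = τ.dualMap ∘ₗ Module.Dual.eval (ZMod p) V := rfl
    rw [← LinearMap.finrank_range_dualMap_eq_finrank_range τ, h, LinearMap.range_comp,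
      LinearMap.range_eq_top.mpr (show Function.Surjective (Module.Dual.eval (ZMod p) V) from
        (Module.evalEquiv (ZMod p) V).surjective), Submodule.map_top]
  have hV := LinearMap.finrank_range_add_finrank_ker τ.flip
  have hW := LinearMap.finrank_range_add_finrank_ker τ
  rw [hrk, ← hV₀] at hV
  rw [← hR] at hW
  -- The composite V → W → W/R is onto, so its kernel has dimension dim V − rank τ = dim V₀; it
  -- contains V₀ by the Jacobi identity.
  have hker : ∀ x ∈ V₀, x ≠ 0 → LinearMap.ker (R.mkQ ∘ₗ β x) = V₀ := by
    intro x hx hx0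
    have hle : V₀ ≤ LinearMap.ker (R.mkQ ∘ₗ β x) := by
      intro y hy
      simpa using hiso x hx y hy
    have hsurj : LinearMap.range (R.mkQ ∘ₗ β x) = ⊤ := by
      rw [LinearMap.range_eq_top]
      exact (Submodule.mkQ_surjective R).comp (hs x hx0)
    have h2 := LinearMap.finrank_range_add_finrank_ker (R.mkQ ∘ₗ β x)
    have h3 := Submodule.finrank_quotient_add_finrank R
    rw [hsurj, finrank_top] at h2
    exact (Submodule.eq_of_le_of_finrank_eq hle (by omega)).symm
  -- If β y₀ x ∈ R with 0 ≠ x ∈ V₀, then `hker` puts y₀ in V₀. So dim V₀ ≤ rank τ, whence dim V ≤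
  -- 2(dim W − dim R), and 2 dim W ≤ dim V forces R = 0.
  have hinj : Function.Injective ((R.mkQ ∘ₗ β y₀) ∘ₗ V₀.subtype) := by
    rw [← LinearMap.ker_eq_bot, LinearMap.ker_eq_bot']
    rintro ⟨x, hx⟩ h
    by_contra hx0
    have hx0' : x ≠ 0 := fun h => hx0 (Subtype.ext h)
    apply hy₀
    rw [← hker x hx hx0']
    have h' : β y₀ x ∈ R := by simpa using h
    simpa [hskew x y₀] using h'
  have h4 := LinearMap.finrank_le_finrank_of_injective hinj
  have h3 := Submodule.finrank_quotient_add_finrank R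
  have : Module.finrank (ZMod p) R = 0 := by omega
  rw [Submodule.finrank_eq_zero] at this
  have hwR : w ∈ R := hw
  rw [this] at hwR
  simpa using hwR

end AlternatingForms

/-! ### Pairings of elementary abelian groups -/

section BilinearGroups

/-- A pairing of commutative groups of exponent `p`, as a bilinear map over the prime field. -/
noncomputable def pairingToBilinear (p : ℕ) {A B C : Type*} [CommGroup A] [CommGroup B]
    [CommGroup C] [Module (ZMod p) (Additive A)] [Module (ZMod p) (Additive B)]
    [Module (ZMod p) (Additive C)] (β : A →* B →* C) :
    Additive A →ₗ[ZMod p] Additive B →ₗ[ZMod p] Additive C :=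
  LinearMap.mk₂ (ZMod p) (fun a b => Additive.ofMul (β a.toMul b.toMul))
    (fun a a' b => by simp)
    (fun c a b => ZMod.map_smul (MonoidHom.toAdditive (β.flip b.toMul)) c a)
    (fun a b b' => by simp)
    (fun c a b => ZMod.map_smul (MonoidHom.toAdditive (β a.toMul)) c b)

/-- If the image of κ b were proper, a nonzero functional killing it would turn κ into a scalar
pairing with b in its left radical. That pairing is nonzero because the values of κ generate C, so
`eq_zero_of_jacobi_pairing` gives b = 1. -/
theorem pairing_surjective_of_jacobi {p : ℕ} [Fact p.Prime] {A B C : Type*} [CommGroup A]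
    [CommGroup B] [CommGroup C] [Finite A] [Finite B] [Module (ZMod p) (Additive A)]
    [Module (ZMod p) (Additive B)] [Module (ZMod p) (Additive C)]
    (β : A →* A →* B) (hβ : ∀ a, β a a = 1) (hs : ∀ a, a ≠ 1 → Function.Surjective (β a))
    (κ : B →* A →* C) (hspan : Subgroup.closure {c | ∃ b a, κ b a = c} = ⊤)
    (hJ : ∀ x y z, κ (β x y) z * κ (β y z) x * κ (β z x) y = 1) (b : B) (hb : b ≠ 1) :
    Function.Surjective (κ b) := by
  have : FiniteDimensional (ZMod p) (Additive A) := Module.Finite.of_finite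
  have : FiniteDimensional (ZMod p) (Additive B) := Module.Finite.of_finite
  let κ' := pairingToBilinear p κ
  change Function.Surjective (κ' (Additive.ofMul b))
  rw [← LinearMap.range_eq_top]
  by_contra hne
  obtain ⟨f, hf0, hf⟩ := Submodule.exists_le_ker_of_lt_top _ (lt_top_iff_ne_top.mpr hne)
  refine hb (Additive.ofMul.injective (eq_zero_of_jacobi_pairing (pairingToBilinear p β)
    hβ (fun a ha => hs a.toMul ha) (κ'.compr₂ f) ?_ ?_ (Additive.ofMul b) ?_))
  · intro h0
    apply hf0
    have hle : Subgroup.closure {c | ∃ b a, κ b a = c} ≤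
        (AddSubgroup.toSubgroup' (LinearMap.ker f).toAddSubgroup) := by
      rw [Subgroup.closure_le]
      rintro c ⟨b, a, rfl⟩
      exact LinearMap.congr_fun (LinearMap.congr_fun h0 (Additive.ofMul b)) (Additive.ofMul a)
    rw [hspan] at hle
    ext c
    exact hle (Subgroup.mem_top c.toMul)
  · intro x y z
    change f (κ' _ _) + f (κ' _ _) + f (κ' _ _) = 0
    rw [← map_add, ← map_add, ← map_zero f]
    exact congrArg f (hJ x y z)
  · ext a
    exact hf ⟨a, rfl⟩

end BilinearGroups

/-! ### Commutator pairings when γ₃ is central -/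

section ClassThree

open scoped IsMulCommutative commutatorElement

variable {G : Type*} [Group G]

theorem commutator_mem_commutator (x y : G) : ⁅x, y⁆ ∈ commutator G :=
  Subgroup.commutator_mem_commutator (Subgroup.mem_top x) (Subgroup.mem_top y)

variable (G) in
/-- The third term of the lower central series. -/
def gammaThree : Subgroup G := ⁅commutator G, (⊤ : Subgroup G)⁆

instance : (gammaThree G).Normal := by unfold gammaThree; infer_instance

theorem commutator_mem_gammaThree {u : G} (hu : u ∈ commutator G) (x : G) :
    ⁅u, x⁆ ∈ gammaThree G :=
  Subgroup.commutator_mem_commutator hu (Subgroup.mem_top x)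

theorem commutator_mem_gammaThree' {u : G} (hu : u ∈ commutator G) (x : G) :
    ⁅x, u⁆ ∈ gammaThree G := by
  rw [← commutatorElement_inv]
  exact inv_mem (commutator_mem_gammaThree hu x)

theorem gammaThree_le : gammaThree G ≤ commutator G :=
  Subgroup.commutator_mono le_top le_rfl

/-- Three subgroups lemma: [γ₃, G] = 1 kills both rotations of [[G, G], G']. -/
theorem isMulCommutative_commutator (h4 : gammaThree G ≤ Subgroup.center G) :
    IsMulCommutative (commutator G) := by
  have h : ⁅gammaThree G, (⊤ : Subgroup G)⁆ = ⊥ := by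
    rw [Subgroup.commutator_eq_bot_iff_le_centralizer]
    exact h4.trans (Subgroup.center_le_centralizer _)
  have h1 : ⁅⁅(⊤ : Subgroup G), (⊤ : Subgroup G)⁆, commutator G⁆ = ⊥ := by
    apply Subgroup.commutator_commutator_eq_bot_of_rotate
    · rw [Subgroup.commutator_comm ⊤ (commutator G)]; exact h
    · exact h
  rw [← Subgroup.le_centralizer_iff_isMulCommutative,
    ← Subgroup.commutator_eq_bot_iff_le_centralizer]
  exact h1

variable (G) in
/-- The commutative quotient `G' / γ₃(G)`. -/
abbrev CommutatorQuotient : Type _ := (commutator G) ⧸ (gammaThree G).subgroupOf (commutator G)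

theorem commutatorQuotient_mk_eq {u v : G} (hu : u ∈ commutator G) (hv : v ∈ commutator G)
    (h : u⁻¹ * v ∈ gammaThree G) :
    (QuotientGroup.mk ⟨u, hu⟩ : CommutatorQuotient G) = QuotientGroup.mk ⟨v, hv⟩ :=
  QuotientGroup.eq.mpr h

variable [IsMulCommutative (commutator G)]

theorem commutator_comm_mem {u v : G} (hu : u ∈ commutator G) (hv : v ∈ commutator G) :
    u * v = v * u :=
  congrArg Subtype.val (mul_comm (⟨u, hu⟩ : commutator G) ⟨v, hv⟩)

theorem commutatorQuotient_mk_eq_one_iff (u : commutator G) :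
    (QuotientGroup.mk u : CommutatorQuotient G) = 1 ↔ (u : G) ∈ gammaThree G :=
  QuotientGroup.eq_one_iff (N := (gammaThree G).subgroupOf (commutator G)) u

/-- The homomorphism `g ↦ [x, g] γ₃(G)`. -/
def commutatorHom (x : G) : G →* CommutatorQuotient G :=
  MonoidHom.mk' (fun g => QuotientGroup.mk ⟨⁅x, g⁆, commutator_mem_commutator x g⟩) <| by
    intro g h
    refine commutatorQuotient_mk_eq _ (mul_mem (commutator_mem_commutator x g)
      (commutator_mem_commutator x h)) ?_
    have : ⁅x, g * h⁆⁻¹ * (⁅x, g⁆ * ⁅x, h⁆) = ⁅g, ⁅x, h⁆⁻¹⁆ := by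
      simp only [commutatorElement_def]; group
    rw [this]
    exact commutator_mem_gammaThree' (inv_mem (commutator_mem_commutator x h)) g

/-- The commutator pairing `G/G' × G/G' → G'/γ₃(G)`. -/
def commutatorPairing : Abelianization G →* Abelianization G →* CommutatorQuotient G :=
  Abelianization.lift <| MonoidHom.mk' (fun x => Abelianization.lift (commutatorHom x)) <| by
    intro x y
    refine Abelianization.hom_ext _ _ (MonoidHom.ext fun g => ?_)
    refine commutatorQuotient_mk_eq _ (mul_mem (commutator_mem_commutator x g)
      (commutator_mem_commutator y g)) ?_
    have h1 : x * ⁅y, g⁆⁻¹ * x⁻¹ ∈ commutator G :=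
      (inferInstance : (commutator G).Normal).conj_mem _ (inv_mem (commutator_mem_commutator y g)) x
    have : ⁅x * y, g⁆⁻¹ * (⁅x, g⁆ * ⁅y, g⁆) = ⁅x, ⁅y, g⁆⁻¹⁆ := by
      have h2 : ⁅x * y, g⁆⁻¹ * (⁅x, g⁆ * ⁅y, g⁆) =
          ⁅x, g⁆⁻¹ * ((x * ⁅y, g⁆⁻¹ * x⁻¹) * ⁅x, g⁆) * ⁅y, g⁆ := by
        rw [commutatorElement_mul_left_eq_conj_mul]; group
      rw [h2, commutator_comm_mem h1 (commutator_mem_commutator x g),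
        commutatorElement_def x ⁅y, g⁆⁻¹]
      group
    rw [this]
    exact commutator_mem_gammaThree' (inv_mem (commutator_mem_commutator y g)) x

/-- The homomorphism `g ↦ [u, g] ∈ γ₃(G)` for `u ∈ G'`. -/
def gammaHom (h4 : gammaThree G ≤ Subgroup.center G) (u : commutator G) : G →* gammaThree G :=
  MonoidHom.mk' (fun g => ⟨⁅(u : G), g⁆, commutator_mem_gammaThree u.2 g⟩) <| by
    intro g h
    ext
    change ⁅(u : G), g * h⁆ = ⁅(u : G), g⁆ * ⁅(u : G), h⁆
    have := Subgroup.mem_center_iff.mp (h4 (commutator_mem_gammaThree u.2 h)) g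
    rw [commutatorElement_mul_right_eq_mul_conj, mul_assoc _ g, this]
    group

instance [h : Fact (gammaThree G ≤ Subgroup.center G)] : IsMulCommutative (gammaThree G) :=
  .of_setLike_mul_comm fun _ _ _ hb => (Subgroup.mem_center_iff.mp (h.out hb) _)

/-- The commutator pairing `G'/γ₃(G) × G/G' → γ₃(G)`. -/
def gammaPairing [h : Fact (gammaThree G ≤ Subgroup.center G)] :
    CommutatorQuotient G →* Abelianization G →* gammaThree G :=
  QuotientGroup.lift _ (MonoidHom.mk' (fun u => Abelianization.lift (gammaHom h.out u)) (by
    intro u v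
    refine Abelianization.hom_ext _ _ (MonoidHom.ext fun g => Subtype.ext ?_)
    change ⁅(u * v : G), g⁆ = ⁅(u : G), g⁆ * ⁅(v : G), g⁆
    have := Subgroup.mem_center_iff.mp (h.out (commutator_mem_gammaThree v.2 g))
    rw [commutatorElement_mul_left_eq_conj_mul, this u, this _]
    group)) <| by
    intro u hu
    refine Abelianization.hom_ext _ _ (MonoidHom.ext fun g => Subtype.ext ?_)
    change ⁅(u : G), g⁆ = 1
    rw [commutatorElement_eq_one_iff_mul_comm]
    exact (Subgroup.mem_center_iff.mp (h.out hu) g).symm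

end ClassThree

/-! ### Conjugacy classes of Camina p-groups of class three -/

section CaminaGroups

open scoped IsMulCommutative commutatorElement

variable {G : Type*} [Group G]

theorem gammaThree_eq_bot_of_le_center (h : commutator G ≤ Subgroup.center G) :
    gammaThree G = ⊥ := by
  unfold gammaThree
  rw [Subgroup.commutator_eq_bot_iff_le_centralizer]
  exact h.trans (Subgroup.center_le_centralizer _)

theorem closure_gammaPairing [Fact (gammaThree G ≤ Subgroup.center G)]
    [IsMulCommutative (commutator G)] :
    Subgroup.closure {c : gammaThree G | ∃ b a, gammaPairing b a = c} = ⊤ := by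
  have h : gammaThree G ≤ (Subgroup.closure
      {c : gammaThree G | ∃ b a, gammaPairing b a = c}).map (gammaThree G).subtype := by
    conv_lhs => unfold gammaThree
    rw [Subgroup.commutator_le]
    intro u hu g _
    exact ⟨_, Subgroup.subset_closure
      ⟨QuotientGroup.mk ⟨u, hu⟩, Abelianization.of g, rfl⟩, rfl⟩
  rw [eq_top_iff]
  rintro c -
  obtain ⟨c', hc', hcc⟩ := h c.2
  rwa [← Subtype.ext hcc]

theorem eq_one_of_pow_injective {p : ℕ} {Q : Type*} [Group Q] (hQ : IsPGroup p Q)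
    (h : ∀ q : Q, q ^ p = 1 → q = 1) (q : Q) : q = 1 := by
  obtain ⟨k, hk⟩ := hQ q
  induction k with
  | zero => simpa using hk
  | succ k ih => exact ih (h _ (by rw [← pow_mul, ← pow_succ]; exact hk))

/-- A finite Camina `p`-group of nilpotency class three, in terms of commutators. -/
structure IsClassThreeCamina (p : ℕ) (G : Type*) [Group G] : Prop where
  isPGroup : IsPGroup p G
  exists_commutator_eq : ∀ x ∉ commutator G, ∀ u ∈ commutator G, ∃ g, ⁅x, g⁆ = u
  gammaThree_le_center : gammaThree G ≤ Subgroup.center G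
  gammaThree_ne_bot : gammaThree G ≠ ⊥

namespace IsClassThreeCamina

variable {p : ℕ}

/-- A central element has only trivial commutators, whereas those of an element outside G' fill G',
which contains γ₃ ≠ 1. -/
theorem center_le_commutator (h : IsClassThreeCamina p G) :
    Subgroup.center G ≤ commutator G := by
  intro z hz
  by_contra hzc
  apply h.gammaThree_ne_bot
  rw [eq_bot_iff]
  intro u hu
  obtain ⟨g, rfl⟩ := h.exists_commutator_eq z hzc u (gammaThree_le hu)
  rw [Subgroup.mem_bot, commutatorElement_eq_one_iff_mul_comm]
  exact (Subgroup.mem_center_iff.mp hz g).symm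

theorem isMulCommutative (h : IsClassThreeCamina p G) : IsMulCommutative (commutator G) :=
  isMulCommutative_commutator h.gammaThree_le_center

theorem not_commutator_le_center (h : IsClassThreeCamina p G) :
    ¬ commutator G ≤ Subgroup.center G :=
  fun hle => h.gammaThree_ne_bot (gammaThree_eq_bot_of_le_center hle)

theorem exists_notMem_commutator (h : IsClassThreeCamina p G) : ∃ x, x ∉ commutator G := by
  by_contra! hall
  have := h.isMulCommutative
  exact h.not_commutator_le_center fun u hu =>
    Subgroup.mem_center_iff.mpr fun g => commutator_comm_mem (hall g) hu

/-- If x^p ∉ G', every element of G'/γ₃ is [x^p, g] = [x, g]^p modulo γ₃. The p-th power map of this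
finite p-group is then onto, hence injective, so the group is trivial and G' = γ₃ is central, which
is excluded. -/
theorem pow_mem_commutator [Finite G] (h : IsClassThreeCamina p G) (x : G) :
    x ^ p ∈ commutator G := by
  by_contra hx
  have := h.isMulCommutative
  have hsurj : Function.Surjective fun q : CommutatorQuotient G => q ^ p := by
    intro q
    obtain ⟨⟨u, hu⟩, rfl⟩ := QuotientGroup.mk_surjective q
    obtain ⟨g, rfl⟩ := h.exists_commutator_eq _ hx u hu
    refine ⟨commutatorPairing (Abelianization.of x) (Abelianization.of g), ?_⟩
    change _ = commutatorPairing (Abelianization.of (x ^ p)) (Abelianization.of g)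
    rw [map_pow, map_pow, MonoidHom.pow_apply]
  have hinj := Finite.injective_iff_surjective.mpr hsurj
  have hQ : IsPGroup p (CommutatorQuotient G) := (h.isPGroup.to_subgroup _).to_quotient _
  have htriv := eq_one_of_pow_injective hQ fun q hq => hinj (by simpa using hq)
  refine h.not_commutator_le_center (le_trans (fun u hu => ?_) h.gammaThree_le_center)
  exact (commutatorQuotient_mk_eq_one_iff ⟨u, hu⟩).mp (htriv _)

theorem abelianization_pow [Finite G] (h : IsClassThreeCamina p G) (a : Abelianization G) :
    a ^ p = 1 := by
  obtain ⟨x, rfl⟩ := QuotientGroup.mk_surjective a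
  exact (QuotientGroup.eq_one_iff (x ^ p)).mpr (h.pow_mem_commutator x)

theorem commutatorPairing_surjective (h : IsClassThreeCamina p G)
    [IsMulCommutative (commutator G)] (a : Abelianization G) (ha : a ≠ 1) :
    Function.Surjective (commutatorPairing a) := by
  obtain ⟨x, rfl⟩ := QuotientGroup.mk_surjective a
  intro q
  obtain ⟨⟨u, hu⟩, rfl⟩ := QuotientGroup.mk_surjective q
  obtain ⟨g, rfl⟩ := h.exists_commutator_eq x
    (fun hx => ha ((QuotientGroup.eq_one_iff x).mpr hx)) u hu
  exact ⟨Abelianization.of g, rfl⟩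

/-- For a fixed x outside G' every q is the pairing of x with some b, and b^p = 1 in G/G'. -/
theorem commutatorQuotient_pow [Finite G] (h : IsClassThreeCamina p G)
    [IsMulCommutative (commutator G)] (q : CommutatorQuotient G) : q ^ p = 1 := by
  obtain ⟨x, hx⟩ := h.exists_notMem_commutator
  obtain ⟨b, rfl⟩ := h.commutatorPairing_surjective (Abelianization.of x)
    (fun h1 => hx ((QuotientGroup.eq_one_iff x).mp h1)) q
  rw [← map_pow, h.abelianization_pow, map_one]

theorem gammaThree_pow [Finite G] (h : IsClassThreeCamina p G) (c : gammaThree G) :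
    c ^ p = 1 := by
  have := h.isMulCommutative
  have : Fact (gammaThree G ≤ Subgroup.center G) := ⟨h.gammaThree_le_center⟩
  have hle : Subgroup.closure {c : gammaThree G | ∃ b a, gammaPairing b a = c} ≤
      (powMonoidHom p : gammaThree G →* gammaThree G).ker := by
    rw [Subgroup.closure_le]
    rintro _ ⟨b, a, rfl⟩
    rw [SetLike.mem_coe, MonoidHom.mem_ker, powMonoidHom_apply, ← map_pow,
      h.abelianization_pow, map_one]
  rw [closure_gammaPairing] at hle
  exact hle (Subgroup.mem_top c)

/-- This is what makes the class of u the full coset of γ₃. All three sections are 𝔽_p-spaces, the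
Camina property makes the first pairing onto, and Hall–Witt is the Jacobi identity. -/
theorem exists_commutator_eq_of_notMem_gammaThree [Finite G] [Fact p.Prime]
    (h : IsClassThreeCamina p G) {u : G} (hu : u ∈ commutator G) (hu3 : u ∉ gammaThree G)
    {c : G} (hc : c ∈ gammaThree G) : ∃ g, ⁅u, g⁆ = c := by
  have := h.isMulCommutative
  have : Fact (gammaThree G ≤ Subgroup.center G) := ⟨h.gammaThree_le_center⟩
  let : Module (ZMod p) (Additive (Abelianization G)) :=
    AddCommGroup.zmodModule h.abelianization_pow
  let : Module (ZMod p) (Additive (CommutatorQuotient G)) :=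
    AddCommGroup.zmodModule h.commutatorQuotient_pow
  let : Module (ZMod p) (Additive (gammaThree G)) :=
    AddCommGroup.zmodModule h.gammaThree_pow
  have hsurj := pairing_surjective_of_jacobi (p := p) (commutatorPairing (G := G)) ?_
    h.commutatorPairing_surjective gammaPairing closure_gammaPairing ?_
    (QuotientGroup.mk ⟨u, hu⟩) (fun h1 => hu3 ((commutatorQuotient_mk_eq_one_iff _).mp h1))
  · obtain ⟨a, ha⟩ := hsurj ⟨c, hc⟩
    obtain ⟨g, rfl⟩ := QuotientGroup.mk_surjective a
    exact ⟨g, congrArg Subtype.val ha⟩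
  · intro a
    obtain ⟨x, rfl⟩ := QuotientGroup.mk_surjective a
    refine (commutatorQuotient_mk_eq_one_iff _).mpr ?_
    change ⁅x, x⁆ ∈ gammaThree G
    rw [commutatorElement_self]
    exact one_mem _
  · intro a b c
    obtain ⟨x, rfl⟩ := QuotientGroup.mk_surjective a
    obtain ⟨y, rfl⟩ := QuotientGroup.mk_surjective b
    obtain ⟨z, rfl⟩ := QuotientGroup.mk_surjective c
    -- The Hall–Witt identity has conjugated outer entries; they agree with the unconjugated ones in
    -- the abelianization.
    have hconj : ∀ x y : G, Abelianization.of (x * y * x⁻¹) = Abelianization.of y := by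
      intro x y
      rw [map_mul, map_mul, map_inv, mul_comm, inv_mul_cancel_left]
    have hW := commutatorElement_commutatorElement_conj_mul x y z
    refine Eq.trans ?_ (Subtype.ext hW : (⟨_, mul_mem (mul_mem
      (commutator_mem_gammaThree (commutator_mem_commutator x y) (y * z * y⁻¹))
      (commutator_mem_gammaThree (commutator_mem_commutator y z) (z * x * z⁻¹)))
      (commutator_mem_gammaThree (commutator_mem_commutator z x) (x * y * x⁻¹))⟩ :
      gammaThree G) = 1)
    exact congrArg₂ _ (congrArg₂ _ (congrArg (gammaPairing _) (hconj y z).symm)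
      (congrArg (gammaPairing _) (hconj z x).symm)) (congrArg (gammaPairing _) (hconj x y).symm)

/-- The commutators of a central element outside γ₃ would be trivial and yet fill γ₃. -/
theorem center_eq_gammaThree [Finite G] [Fact p.Prime] (h : IsClassThreeCamina p G) :
    Subgroup.center G = gammaThree G := by
  refine le_antisymm (fun z hz => ?_) h.gammaThree_le_center
  by_contra hz3
  refine h.gammaThree_ne_bot (eq_bot_iff.mpr fun c hc => ?_)
  obtain ⟨g, rfl⟩ :=
    h.exists_commutator_eq_of_notMem_gammaThree (h.center_le_commutator hz) hz3 hc
  rw [Subgroup.mem_bot, commutatorElement_eq_one_iff_mul_comm]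
  exact (Subgroup.mem_center_iff.mp hz g).symm

theorem pow_mem_center [Finite G] [Fact p.Prime] (h : IsClassThreeCamina p G) {u : G}
    (hu : u ∈ commutator G) : u ^ p ∈ Subgroup.center G := by
  have := h.isMulCommutative
  rw [h.center_eq_gammaThree]
  exact (commutatorQuotient_mk_eq_one_iff ((⟨u, hu⟩ : commutator G) ^ p)).mp
    (h.commutatorQuotient_pow (QuotientGroup.mk ⟨u, hu⟩))

theorem pow_eq_one_of_mem_center [Finite G] [Fact p.Prime] (h : IsClassThreeCamina p G) {z : G}
    (hz : z ∈ Subgroup.center G) : z ^ p = 1 := by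
  rw [h.center_eq_gammaThree] at hz
  exact congrArg Subtype.val (h.gammaThree_pow ⟨z, hz⟩)

/-- Multiplying an element outside `G'` by an element of `G'` does not change its class. -/
theorem isConj_mul_of_notMem_commutator (h : IsClassThreeCamina p G) {x u : G}
    (hx : x ∉ commutator G) (hu : u ∈ commutator G) : IsConj x (u * x) := by
  obtain ⟨g, hg⟩ := h.exists_commutator_eq x hx u⁻¹ (inv_mem hu)
  rw [isConj_iff]
  refine ⟨g, ?_⟩
  rw [← inv_inv u, ← hg, commutatorElement_def]
  group

/-- Multiplying a noncentral element by a central element does not change its class. -/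
theorem isConj_mul_of_notMem_center [Finite G] [Fact p.Prime] (h : IsClassThreeCamina p G)
    {x u : G} (hx : x ∉ Subgroup.center G) (hu : u ∈ Subgroup.center G) :
    IsConj x (u * x) := by
  by_cases hxc : x ∈ commutator G
  · rw [h.center_eq_gammaThree] at hx hu
    obtain ⟨g, hg⟩ := h.exists_commutator_eq_of_notMem_gammaThree hxc hx (inv_mem hu)
    rw [isConj_iff]
    refine ⟨g, ?_⟩
    rw [← inv_inv u, ← hg, commutatorElement_def]
    group
  · exact h.isConj_mul_of_notMem_commutator hxc (h.center_le_commutator hu)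

theorem mul_inv_mem_center_of_isConj [Finite G] [Fact p.Prime] (h : IsClassThreeCamina p G)
    {x y : G} (hx : x ∈ commutator G) (hxy : IsConj x y) : y * x⁻¹ ∈ Subgroup.center G := by
  obtain ⟨g, rfl⟩ := isConj_iff.mp hxy
  rw [h.center_eq_gammaThree]
  exact commutator_mem_gammaThree' hx g

theorem of_isCamina [Finite G] [Group.IsNilpotent G] (hp : IsPGroup p G) (hC : IsCamina G)
    (hclass : Group.nilpotencyClass G = 3) : IsClassThreeCamina p G where
  isPGroup := hp
  exists_commutator_eq := by
    intro x hx u hu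
    have hx' : (ConjClasses.mk x).carrier ⊆ (commutator G : Set G)ᶜ := by
      intro y hy hyc
      rw [ConjClasses.mem_carrier_iff_mk_eq, ConjClasses.mk_eq_mk_iff_isConj] at hy
      obtain ⟨g, rfl⟩ := isConj_iff.mp hy
      apply hx
      have := (inferInstance : (commutator G).Normal).conj_mem _ hyc g
      exact this
    obtain ⟨g, hg⟩ := hC _ hx'
    have h1 : x ∈ (ConjClasses.mk x).carrier := ConjClasses.mem_carrier_mk
    -- The class is a coset of G', so it contains u⁻¹x. A conjugation c x c⁻¹ = u⁻¹x then reads [x,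
    -- c] = u.
    have h2 : u⁻¹ * x ∈ (ConjClasses.mk x).carrier := by
      rw [hg] at h1 ⊢
      obtain ⟨v, hv, hxv⟩ := h1
      refine ⟨v * (x⁻¹ * u⁻¹ * x), mul_mem hv ?_, ?_⟩
      · have := (inferInstance : (commutator G).Normal).conj_mem _ (inv_mem hu) x⁻¹
        simpa using this
      · rw [← mul_assoc, ← hxv]; group
    rw [ConjClasses.mem_carrier_iff_mk_eq, ConjClasses.mk_eq_mk_iff_isConj] at h2
    obtain ⟨c, hc⟩ := isConj_iff.mp h2.symm
    refine ⟨c, ?_⟩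
    rw [commutatorElement_def]
    have : x * c * x⁻¹ * c⁻¹ = x * (c * x * c⁻¹)⁻¹ := by group
    rw [this, hc]; group
  gammaThree_le_center := by
    -- The series is indexed from 0: its term 3 is γ₄ = [γ₃, G], and its term 2 is γ₃.
    have h : (⊤ : Subgroup G).lowerCentralSeries 3 = ⊥ := by
      rw [← hclass]; exact Subgroup.lowerCentralSeries_nilpotencyClass
    have h' : ⁅gammaThree G, (⊤ : Subgroup G)⁆ = ⊥ := h
    rw [Subgroup.commutator_eq_bot_iff_le_centralizer] at h'
    rwa [Subgroup.coe_top, Subgroup.centralizer_univ] at h'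
  gammaThree_ne_bot := by
    intro h
    have h' : (⊤ : Subgroup G).lowerCentralSeries 2 = ⊥ := h
    rw [Subgroup.lowerCentralSeries_eq_bot_iff_nilpotencyClass_le] at h'
    omega

end IsClassThreeCamina

end CaminaGroups

/-! ### Scalar idempotents and direct sums of ideals -/

section ScalarIdempotents

variable {R : Type*} [Ring R] [Algebra ℂ R]

/-- A nonzero idempotent on which the whole algebra acts by scalars from both sides. -/
structure IsScalarIdempotent (e : R) : Prop where
  ne_zero : e ≠ 0
  idem : IsIdempotentElem e
  mul_left : ∀ t : R, ∃ c : ℂ, t * e = c • e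
  mul_right : ∀ t : R, ∃ c : ℂ, e * t = c • e

namespace IsScalarIdempotent

/-- The two-sided ideal is additively generated by the products a e d, and each of these is a scalar
multiple of e. -/
theorem mem_idealGen {e : R} (he : IsScalarIdempotent e) {x : R} :
    x ∈ idealGen e ↔ ∃ c : ℂ, c • e = x := by
  constructor
  · intro hx
    have hx' : x ∈ TwoSidedIdeal.span {e} := hx
    rw [TwoSidedIdeal.mem_span_iff_mem_addSubgroup_closure] at hx'
    refine AddSubgroup.closure_induction ?_ ⟨0, zero_smul _ _⟩ ?_ ?_ hx'
    · rintro y ⟨z, ⟨a, -, b, hb, rfl⟩, d, -, rfl⟩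
      rw [Set.mem_singleton_iff] at hb
      subst hb
      obtain ⟨c, hc⟩ := he.mul_left a
      obtain ⟨c', hc'⟩ := he.mul_right d
      exact ⟨c * c', by simp only [hc, smul_mul_assoc, hc', smul_smul]⟩
    · rintro _ _ _ _ ⟨c, rfl⟩ ⟨d, rfl⟩
      exact ⟨c + d, add_smul _ _ _⟩
    · rintro _ _ ⟨c, rfl⟩
      exact ⟨-c, neg_smul _ _⟩
  · rintro ⟨c, rfl⟩
    have he' : e ∈ idealGen e := TwoSidedIdeal.subset_span (Set.mem_singleton e)
    rw [Algebra.smul_def]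
    exact Ideal.mul_mem_left _ _ he'

theorem self_mem_idealGen {e : R} (he : IsScalarIdempotent e) : e ∈ idealGen e :=
  he.mem_idealGen.mpr ⟨1, one_smul _ _⟩

theorem finrank_idealGen {e : R} (he : IsScalarIdempotent e) :
    Module.finrank ℂ ((idealGen e).restrictScalars ℂ) = 1 := by
  refine finrank_eq_one ⟨e, he.self_mem_idealGen⟩
    (fun h => he.ne_zero (congrArg Subtype.val h)) ?_
  rintro ⟨x, hx⟩
  obtain ⟨c, rfl⟩ := he.mem_idealGen.mp hx
  exact ⟨c, rfl⟩

theorem isMinimalTwoSided {e : R} (he : IsScalarIdempotent e) :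
    IsMinimalTwoSided (idealGen e) := by
  refine ⟨inferInstanceAs (TwoSidedIdeal.asIdeal _).IsTwoSided, fun h => ?_, fun J _ hJ => ?_⟩
  · have := he.self_mem_idealGen
    rw [h] at this
    exact he.ne_zero this
  · by_cases hb : J = ⊥
    · exact Or.inl hb
    · right
      obtain ⟨x, hx, hx0⟩ := Submodule.exists_mem_ne_zero_of_ne_bot hb
      obtain ⟨c, rfl⟩ := he.mem_idealGen.mp (hJ hx)
      have hc : c ≠ 0 := by rintro rfl; exact hx0 (zero_smul _ _)
      refine le_antisymm hJ fun y hy => ?_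
      obtain ⟨d, rfl⟩ := he.mem_idealGen.mp hy
      have : d • e = algebraMap ℂ R (d * c⁻¹) * (c • e) := by
        rw [← Algebra.smul_def, smul_smul, mul_assoc, inv_mul_cancel₀ hc, mul_one]
      rw [this]
      exact J.mul_mem_left _ hx

theorem eq_of_smul_eq {e e' : R} (he : IsScalarIdempotent e) (he' : IsScalarIdempotent e') {r : ℂ}
    (h : e' = r • e) : e' = e := by
  have h1 := he'.idem
  rw [IsIdempotentElem, h, smul_mul_smul_comm, he.idem.eq, ← sub_eq_zero, ← sub_smul,
    smul_eq_zero, or_iff_left he.ne_zero] at h1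
  have hr : r ≠ 0 := by
    rintro rfl
    exact he'.ne_zero (by rw [h, zero_smul])
  have hr1 : r = 1 := mul_left_cancel₀ hr (by linear_combination h1)
  rw [h, hr1, one_smul]

/-- The product is a multiple of e and of e'. If it were nonzero the two lines would coincide, and a
line contains only one nonzero idempotent. -/
theorem mul_eq_zero_of_ne {e e' : R} (he : IsScalarIdempotent e) (he' : IsScalarIdempotent e')
    (hne : e ≠ e') : e * e' = 0 := by
  obtain ⟨c, hc⟩ := he'.mul_left e
  obtain ⟨d, hd⟩ := he.mul_right e'
  by_cases hc0 : c = 0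
  · rw [hc, hc0, zero_smul]
  · refine absurd (he.eq_of_smul_eq he' (r := c⁻¹ * d) ?_).symm hne
    rw [mul_smul, ← hd, hc, smul_smul, inv_mul_cancel₀ hc0, one_smul]

theorem eq_of_idealGen_eq {e e' : R} (he : IsScalarIdempotent e) (he' : IsScalarIdempotent e')
    (h : idealGen e = idealGen e') : e = e' := by
  have h1 := he'.self_mem_idealGen
  rw [← h] at h1
  obtain ⟨r, hr⟩ := he.mem_idealGen.mp h1
  exact (he.eq_of_smul_eq he' hr.symm).symm

end IsScalarIdempotent

/-- Right multiplication by `e i` is left linear, fixes `I i` pointwise and kills the other ideals,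
so `I i` meets their sum in 0. -/
theorem isInternal_of_mul_idempotents {R ι : Type*} [Ring R] [DecidableEq ι]
    (I : ι → Ideal R) (e : ι → R)
    (h1 : ∀ i, ∀ x ∈ I i, x * e i = x) (h0 : ∀ i j, j ≠ i → ∀ x ∈ I j, x * e i = 0)
    (htop : (1 : R) ∈ ⨆ i, I i) : DirectSum.IsInternal I := by
  rw [DirectSum.isInternal_submodule_iff_iSupIndep_and_iSup_eq_top]
  refine ⟨fun i => ?_, (Ideal.eq_top_iff_one _).mpr htop⟩
  rw [Submodule.disjoint_def]
  intro x hx hx'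
  have hle : ⨆ j, ⨆ (_ : j ≠ i), I j ≤ LinearMap.ker (LinearMap.toSpanSingleton R R (e i)) :=
    iSup_le fun j => iSup_le fun hj y hy => by
      rw [LinearMap.mem_ker, LinearMap.toSpanSingleton_apply]
      exact h0 i j hj y hy
  rw [← h1 i x hx]
  exact hle hx'

end ScalarIdempotents

/-- Used to carry the trivial action of the primary idempotent from the primary module to every left
ideal isomorphic to it. -/
theorem smul_eq_of_linearEquiv {R M M' : Type*} [Ring R] [AddCommGroup M] [AddCommGroup M']
    [Module R M] [Module R M'] {N : Submodule R M} {S : Submodule R M'} (φ : N ≃ₗ[R] S) {r : R}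
    (hr : ∀ s ∈ S, r • s = s) {n : M} (hn : n ∈ N) : r • n = n := by
  have h : r • (⟨n, hn⟩ : N) = ⟨n, hn⟩ := by
    apply φ.injective
    rw [map_smul]
    exact Subtype.ext (hr _ (φ ⟨n, hn⟩).2)
  exact congrArg Subtype.val h

/-! ### The primary component -/

section Primary

open scoped Classical

variable {G : Type*} [Group G]

theorem conjClasses_mk_conj (g x : G) : ConjClasses.mk (g * x * g⁻¹) = ConjClasses.mk x :=
  ConjClasses.mk_eq_mk_iff_isConj.mpr (isConj_iff.mpr ⟨g, rfl⟩).symm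

theorem apply_eq_of_mk_eq {α : Type*} {f : G → α} (hf : ∀ g x, f (g * x * g⁻¹) = f x) {x y : G}
    (h : ConjClasses.mk x = ConjClasses.mk y) : f x = f y := by
  obtain ⟨g, rfl⟩ := isConj_iff.mp (ConjClasses.mk_eq_mk_iff_isConj.mp h)
  exact (hf g x).symm

theorem conjClasses_mk_eq_one_iff {x : G} : ConjClasses.mk x = 1 ↔ x = 1 := by
  rw [ConjClasses.one_eq_mk_one, ConjClasses.mk_eq_mk_iff_isConj, isConj_comm, isConj_one_right,
    eq_comm]

variable [Fintype G] [DecidableEq G]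

theorem adjMatrix_apply (c : ConjClasses G) (x y : G) :
    adjMatrix c x y = if ConjClasses.mk (y * x⁻¹) = c then 1 else 0 := by
  simp only [adjMatrix, of_apply, ConjClasses.mem_carrier_iff_mk_eq]

theorem dualIdempotent_eq (c : ConjClasses G) :
    dualIdempotent c = diagonal fun x => if ConjClasses.mk x = c then 1 else 0 := by
  simp only [dualIdempotent, ConjClasses.mem_carrier_iff_mk_eq]

theorem dualIdempotent_mul_apply (c : ConjClasses G) (M : Matrix G G ℂ) (x y : G) :
    (dualIdempotent c * M) x y = if ConjClasses.mk x = c then M x y else 0 := by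
  rw [dualIdempotent_eq, diagonal_mul, ite_mul, one_mul, zero_mul]

theorem mul_dualIdempotent_apply (c : ConjClasses G) (M : Matrix G G ℂ) (x y : G) :
    (M * dualIdempotent c) x y = if ConjClasses.mk y = c then M x y else 0 := by
  rw [dualIdempotent_eq, mul_diagonal, mul_ite, mul_one, mul_zero]

theorem terwilliger_ext {s t : terwilligerAlgebra G}
    (h : ∀ x y, (s : Matrix G G ℂ) x y = (t : Matrix G G ℂ) x y) : s = t :=
  Subtype.ext (Matrix.ext h)

/-- The entries of the elements of `T(G)` are invariant under simultaneous conjugation. -/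
theorem terwilliger_conj_apply (t : terwilligerAlgebra G) (g x y : G) :
    (t : Matrix G G ℂ) (g * x * g⁻¹) (g * y * g⁻¹) = (t : Matrix G G ℂ) x y := by
  obtain ⟨t, ht⟩ := t
  change t _ _ = t x y
  induction ht using Algebra.adjoin_induction generalizing x y with
  | mem t ht =>
    rcases ht with ⟨c, rfl⟩ | ⟨c, rfl⟩
    · rw [adjMatrix_apply, adjMatrix_apply]
      have : g * y * g⁻¹ * (g * x * g⁻¹)⁻¹ = g * (y * x⁻¹) * g⁻¹ := by group
      rw [this, conjClasses_mk_conj]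
    · simp only [dualIdempotent_eq, diagonal_apply, conjClasses_mk_conj, mul_left_inj, mul_right_inj]
  | algebraMap r => simp [Matrix.algebraMap_matrix_apply]
  | add s t _ _ hs ht => simp only [Matrix.add_apply, hs, ht]
  | mul s t _ _ hs ht =>
    simp only [Matrix.mul_apply]
    rw [← Equiv.sum_comp (MulAut.conj g).toEquiv]
    exact Finset.sum_congr rfl fun w _ => congrArg₂ _ (hs x w) (ht w y)

variable (G) in
/-- The average of the permutation matrices of conjugations. -/
noncomputable def conjAverage : Matrix G G ℂ :=
  of fun x y => (Fintype.card G : ℂ)⁻¹ * ∑ g : G, if g * x * g⁻¹ = y then 1 else 0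

theorem conjAverage_mul_apply (M : Matrix G G ℂ) (x z : G) :
    (conjAverage G * M) x z = (Fintype.card G : ℂ)⁻¹ * ∑ g : G, M (g * x * g⁻¹) z := by
  simp only [Matrix.mul_apply, conjAverage, of_apply, mul_assoc, ← Finset.mul_sum,
    Finset.sum_mul]
  rw [Finset.sum_comm]
  simp

theorem mul_conjAverage_apply (M : Matrix G G ℂ) (x z : G) :
    (M * conjAverage G) x z = (Fintype.card G : ℂ)⁻¹ * ∑ g : G, M x (g⁻¹ * z * g) := by
  simp only [Matrix.mul_apply, conjAverage, of_apply, Finset.mul_sum]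
  rw [Finset.sum_comm]
  refine Finset.sum_congr rfl fun g _ => ?_
  rw [Finset.sum_eq_single (g⁻¹ * z * g)]
  · rw [if_pos (by group)]; ring
  · intro y _ hy
    rw [if_neg (fun h => hy (by rw [← h]; group))]; ring
  · simp

/-- Entries of elements of T(G) are invariant under simultaneous conjugation, so these elements
commute with every conjugation permutation matrix and with the average. -/
theorem conjAverage_commute (t : terwilligerAlgebra G) :
    conjAverage G * (t : Matrix G G ℂ) = (t : Matrix G G ℂ) * conjAverage G := by
  ext x z
  rw [conjAverage_mul_apply, mul_conjAverage_apply]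
  congr 1
  refine Finset.sum_congr rfl fun g _ => ?_
  rw [← terwilliger_conj_apply t g x (g⁻¹ * z * g)]
  group

/-- Right multiplication by the average fixes the matrices with class functions as rows. -/
theorem mul_conjAverage_of_class (M : Matrix G G ℂ)
    (hM : ∀ x y g, M x (g * y * g⁻¹) = M x y) : M * conjAverage G = M := by
  ext x z
  rw [mul_conjAverage_apply]
  have : ∀ g : G, M x (g⁻¹ * z * g) = M x z := fun g => by
    simpa using hM x z g⁻¹
  simp [this]

theorem conjAverage_conj_left (g x y : G) :
    conjAverage G (g * x * g⁻¹) y = conjAverage G x y := by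
  simp only [conjAverage, of_apply]
  congr 1
  refine Fintype.sum_equiv (Equiv.mulRight g) _ _ fun h => ?_
  simp [mul_assoc]

theorem conjAverage_conj_right (g x y : G) :
    conjAverage G x (g * y * g⁻¹) = conjAverage G x y := by
  simp only [conjAverage, of_apply]
  congr 1
  refine Fintype.sum_equiv (Equiv.mulLeft g⁻¹) _ _ fun h => ?_
  refine if_congr ?_ rfl rfl
  simp only [Equiv.coe_mulLeft]
  constructor
  · intro hh
    calc g⁻¹ * h * x * (g⁻¹ * h)⁻¹ = g⁻¹ * (h * x * h⁻¹) * g := by group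
      _ = y := by rw [hh]; group
  · intro hh
    rw [← hh]; group

/-- The matrix with all entries `1` in the `C_i, C_k` block and `0` elsewhere. -/
noncomputable def blockOnes (i k : ConjClasses G) : terwilligerAlgebra G :=
  dualT i * (∑ c, adjT c) * dualT k

theorem blockOnes_apply (i k : ConjClasses G) (x y : G) :
    (blockOnes i k : Matrix G G ℂ) x y =
      if ConjClasses.mk x = i ∧ ConjClasses.mk y = k then 1 else 0 := by
  have : ((∑ c, adjT c : terwilligerAlgebra G) : Matrix G G ℂ) x y = 1 := by
    rw [AddSubmonoidClass.coe_finsetSum, Matrix.sum_apply]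
    simp [adjT, adjMatrix_apply]
  change (dualIdempotent i * ((∑ c, adjT c : terwilligerAlgebra G) : Matrix G G ℂ) *
    dualIdempotent k) x y = _
  rw [mul_dualIdempotent_apply, dualIdempotent_mul_apply, this]
  simp only [ite_and]
  split_ifs <;> rfl

variable (G) in
/-- The central idempotent of `T(G)` that belongs to the primary module. -/
noncomputable def primaryIdem : terwilligerAlgebra G :=
  ∑ k : ConjClasses G, (conjAverage G k.out k.out) • blockOnes k k

theorem coe_primaryIdem : (primaryIdem G : Matrix G G ℂ) = conjAverage G := by
  ext x y
  have hx : ConjClasses.mk (ConjClasses.mk x).out = ConjClasses.mk x := Quotient.out_eq _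
  rw [primaryIdem, AddSubmonoidClass.coe_finsetSum, Matrix.sum_apply]
  simp only [SetLike.val_smul, Matrix.smul_apply, blockOnes_apply, smul_eq_mul, mul_ite, mul_one,
    mul_zero]
  rw [Finset.sum_eq_single (ConjClasses.mk x)]
  · by_cases h : ConjClasses.mk y = ConjClasses.mk x
    · rw [if_pos ⟨rfl, h⟩]
      rw [apply_eq_of_mk_eq (f := fun w => conjAverage G w _)
        (fun g w => conjAverage_conj_left g w _) hx]
      exact apply_eq_of_mk_eq (f := fun w => conjAverage G x w)
        (fun g w => conjAverage_conj_right g x w) (hx.trans h.symm)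
    · rw [if_neg (fun h' => h h'.2)]
      simp only [conjAverage, of_apply]
      rw [Finset.sum_eq_zero, mul_zero]
      intro g _
      rw [if_neg]
      rintro rfl
      exact h (conjClasses_mk_conj g x)
  · intro k _ hk
    rw [if_neg (fun h => hk h.1.symm)]
  · simp

theorem primaryIdem_comm (t : terwilligerAlgebra G) : primaryIdem G * t = t * primaryIdem G :=
  Subtype.ext (by
    rw [MulMemClass.coe_mul, MulMemClass.coe_mul, coe_primaryIdem, conjAverage_commute])

theorem mul_primaryIdem_of_class (t : terwilligerAlgebra G)
    (ht : ∀ x y g, (t : Matrix G G ℂ) x (g * y * g⁻¹) = (t : Matrix G G ℂ) x y) :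
    t * primaryIdem G = t :=
  Subtype.ext (by rw [MulMemClass.coe_mul, coe_primaryIdem, mul_conjAverage_of_class _ ht])

/-- The class of the identity is a single point, so the product acquires no factor: every block of
ones factors through the base point. -/
theorem blockOnes_one_mul (i k : ConjClasses G) :
    blockOnes i 1 * blockOnes 1 k = blockOnes i k := by
  refine terwilliger_ext fun x y => ?_
  rw [MulMemClass.coe_mul, Matrix.mul_apply]
  simp only [blockOnes_apply, conjClasses_mk_eq_one_iff]
  rw [Finset.sum_eq_single 1]
  · simp only [and_true, true_and, ite_and]
    split_ifs <;> simp
  · intro w _ hw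
    simp [hw]
  · simp

theorem primaryIdem_smul_single :
    primaryIdem G • (Pi.single (1 : G) (1 : ℂ) : G → ℂ) = Pi.single 1 1 := by
  funext x
  rw [terwilligerAlgebra_smul_eq, coe_primaryIdem, Matrix.mulVec_single_one]
  simp only [Matrix.col_apply, conjAverage, of_apply]
  by_cases hx : x = 1
  · subst hx; simp
  · simp [hx, mul_inv_eq_one]

theorem primaryIdem_smul_of_mem {v : G → ℂ} (hv : v ∈ primaryModule G) :
    primaryIdem G • v = v := by
  obtain ⟨t, rfl⟩ := Submodule.mem_span_singleton.mp hv
  rw [smul_smul, primaryIdem_comm, mul_smul, primaryIdem_smul_single]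

/-- The columns of the product indexed by the class k all equal t applied to the base vector; the
others vanish. Equal annihilators make the left ideal of this block isomorphic to the primary
module. -/
theorem mul_blockOnes_one_eq_zero_iff (k : ConjClasses G) (t : terwilligerAlgebra G) :
    t * blockOnes 1 k = 0 ↔ t • (Pi.single (1 : G) (1 : ℂ) : G → ℂ) = 0 := by
  have h1 : ∀ x y, ((t * blockOnes 1 k : terwilligerAlgebra G) : Matrix G G ℂ) x y =
      if ConjClasses.mk y = k then (t : Matrix G G ℂ) x 1 else 0 := by
    intro x y
    rw [MulMemClass.coe_mul, Matrix.mul_apply]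
    simp only [blockOnes_apply, conjClasses_mk_eq_one_iff]
    rw [Finset.sum_eq_single 1]
    · simp
    · intro w _ hw
      simp [hw]
    · simp
  rw [terwilligerAlgebra_smul_eq, Matrix.mulVec_single_one]
  constructor
  · intro h
    funext x
    obtain ⟨y, rfl⟩ := ConjClasses.mk_surjective k
    have := h1 x y
    rw [h, if_pos rfl] at this
    exact this.symm
  · intro h
    refine terwilliger_ext fun x y => ?_
    have hx : (t : Matrix G G ℂ) x 1 = 0 := congrFun h x
    rw [h1, hx, ite_self]
    rfl

theorem blockOnes_mem_primaryComponent (i k : ConjClasses G) :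
    blockOnes i k ∈ primaryComponent G := by
  rw [← blockOnes_one_mul]
  refine Ideal.mul_mem_left _ _ ?_
  have hker : LinearMap.ker (LinearMap.toSpanSingleton (terwilligerAlgebra G) _ (blockOnes 1 k)) =
      LinearMap.ker (LinearMap.toSpanSingleton (terwilligerAlgebra G) (G → ℂ)
        (Pi.single (1 : G) (1 : ℂ))) := by
    ext t
    exact mul_blockOnes_one_eq_zero_iff k t
  have e : (Submodule.span (terwilligerAlgebra G) {blockOnes 1 k}) ≃ₗ[terwilligerAlgebra G]
      primaryModule G :=
    (LinearEquiv.ofEq _ _ (LinearMap.range_toSpanSingleton _).symm) ≪≫ₗ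
    (LinearMap.quotKerEquivRange _).symm ≪≫ₗ (Submodule.quotEquivOfEq _ _ hker) ≪≫ₗ
    (LinearMap.quotKerEquivRange _) ≪≫ₗ
    (LinearEquiv.ofEq _ _ (LinearMap.range_toSpanSingleton _))
  have hle : Submodule.span (terwilligerAlgebra G) {blockOnes 1 k} ≤ primaryComponent G :=
    le_sSup (Nonempty.intro e)
  exact hle (Submodule.mem_span_singleton_self _)

theorem primaryIdem_mem_primaryComponent : primaryIdem G ∈ primaryComponent G :=
  Submodule.sum_mem _ fun _ _ => Submodule.smul_of_tower_mem _ _ (blockOnes_mem_primaryComponent _ _)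

/-- The primary component is the ideal generated by the primary central idempotent. -/
theorem mem_primaryComponent {t : terwilligerAlgebra G} :
    t ∈ primaryComponent G ↔ t * primaryIdem G = t := by
  constructor
  · intro ht
    have hle : primaryComponent G ≤ LinearMap.ker
        (LinearMap.toSpanSingleton (terwilligerAlgebra G) _ (primaryIdem G) - LinearMap.id) := by
      refine sSup_le ?_
      -- The primary idempotent acts as the identity on the primary module, hence on every left
      -- ideal isomorphic to it.
      rintro N ⟨φ⟩ n hn
      rw [LinearMap.mem_ker, LinearMap.sub_apply, LinearMap.toSpanSingleton_apply, sub_eq_zero,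
        smul_eq_mul, ← primaryIdem_comm]
      exact smul_eq_of_linearEquiv φ (fun v hv => primaryIdem_smul_of_mem hv) hn
    have := hle ht
    rwa [LinearMap.mem_ker, LinearMap.sub_apply, LinearMap.toSpanSingleton_apply, sub_eq_zero] at this
  · intro ht
    rw [← ht]
    exact Ideal.mul_mem_left _ _ primaryIdem_mem_primaryComponent

/-- The matrices in the primary component are constant on blocks. -/
theorem apply_eq_of_mem_primaryComponent {t : terwilligerAlgebra G} (ht : t ∈ primaryComponent G)
    {x x' y y' : G} (hx : ConjClasses.mk x = ConjClasses.mk x')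
    (hy : ConjClasses.mk y = ConjClasses.mk y') :
    (t : Matrix G G ℂ) x y = (t : Matrix G G ℂ) x' y' := by
  have h1 := congrArg Subtype.val (mem_primaryComponent.mp ht)
  have h2 := h1
  rw [← primaryIdem_comm] at h2
  rw [MulMemClass.coe_mul, coe_primaryIdem] at h1 h2
  have hr : ∀ g w, (t : Matrix G G ℂ) x (g * w * g⁻¹) = (t : Matrix G G ℂ) x w := by
    intro g w
    rw [← h1]
    simp only [Matrix.mul_apply, conjAverage_conj_right]
  have hl : ∀ g w, (t : Matrix G G ℂ) (g * w * g⁻¹) y' = (t : Matrix G G ℂ) w y' := by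
    intro g w
    rw [← h2]
    simp only [Matrix.mul_apply, conjAverage_conj_left]
  exact (apply_eq_of_mk_eq hr hy).trans (apply_eq_of_mk_eq (f := fun w => (t : Matrix G G ℂ) w y') hl hx)

/-- A nonzero M here is constant on blocks, so sandwiching a nonzero block between blocks of ones at
the base point yields a nonzero multiple of the (1, 1) block. All diagonal blocks of ones factor
through that one, so it generates the whole component. -/
theorem isMinimalTwoSided_primaryComponent : IsMinimalTwoSided (primaryComponent G) := by
  refine ⟨⟨fun s ht => ?_⟩, fun h => ?_, fun J hJ hle => ?_⟩
  · rw [mem_primaryComponent] at ht ⊢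
    rw [mul_assoc, ← primaryIdem_comm, ← mul_assoc, ht]
  · have h1 := blockOnes_mem_primaryComponent (G := G) 1 1
    rw [h] at h1
    have h2 := blockOnes_apply (G := G) 1 1 1 1
    rw [(Submodule.mem_bot _).mp h1, if_pos ⟨rfl, rfl⟩] at h2
    exact zero_ne_one h2
  by_cases hb : J = ⊥
  · exact Or.inl hb
  right
  obtain ⟨M, hM, hM0⟩ := Submodule.exists_mem_ne_zero_of_ne_bot hb
  obtain ⟨x, y, hxy⟩ : ∃ x y, (M : Matrix G G ℂ) x y ≠ 0 := by
    by_contra! hall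
    exact hM0 (terwilliger_ext hall)
  have hone : blockOnes (1 : ConjClasses G) 1 ∈ J := by
    -- This is |C_x| |C_y| M x y, kept as a double sum to match the matrix product; it is nonzero
    -- because the count is positive.
    let r : ℂ := ∑ w : G, ∑ v : G, if ConjClasses.mk v = ConjClasses.mk x ∧
      ConjClasses.mk w = ConjClasses.mk y then (M : Matrix G G ℂ) x y else 0
    have hr : r ≠ 0 := by
      have : r = (∑ w : G, ∑ v : G, if ConjClasses.mk v = ConjClasses.mk x ∧
          ConjClasses.mk w = ConjClasses.mk y then (1 : ℝ) else 0 : ℝ) * (M : Matrix G G ℂ) x y := by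
        push_cast
        simp only [r, Finset.sum_mul, ite_mul, one_mul, zero_mul, apply_ite Complex.ofReal,
          Complex.ofReal_one, Complex.ofReal_zero]
      rw [this]
      refine mul_ne_zero (Complex.ofReal_ne_zero.mpr (ne_of_gt ?_)) hxy
      refine Finset.sum_pos' (fun w _ => Finset.sum_nonneg fun v _ => by positivity)
        ⟨y, Finset.mem_univ _, Finset.sum_pos' (fun v _ => by positivity)
          ⟨x, Finset.mem_univ _, by simp⟩⟩
    have hprod : blockOnes 1 (ConjClasses.mk x) * M * blockOnes (ConjClasses.mk y) 1 =
        r • blockOnes (1 : ConjClasses G) 1 := by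
      refine terwilliger_ext fun a b => ?_
      rw [MulMemClass.coe_mul, MulMemClass.coe_mul, Matrix.mul_apply, SetLike.val_smul,
        Matrix.smul_apply]
      simp only [Matrix.mul_apply, blockOnes_apply, smul_eq_mul, r, Finset.sum_mul]
      refine Finset.sum_congr rfl fun w _ => Finset.sum_congr rfl fun v _ => ?_
      by_cases hv : ConjClasses.mk v = ConjClasses.mk x
      · by_cases hw : ConjClasses.mk w = ConjClasses.mk y
        · rw [apply_eq_of_mem_primaryComponent (hle hM) hv hw]
          by_cases ha : ConjClasses.mk a = 1 <;> by_cases hb : ConjClasses.mk b = 1 <;>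
            simp [ha, hb, hv, hw]
        · simp [hw]
      · simp [hv]
    have hmem : r⁻¹ • (r • blockOnes (1 : ConjClasses G) 1) ∈ J := by
      refine Submodule.smul_of_tower_mem _ _ ?_
      rw [← hprod]
      exact J.mul_mem_right _ (J.mul_mem_left _ hM)
    rwa [smul_smul, inv_mul_cancel₀ hr, one_smul] at hmem
  refine le_antisymm hle fun t ht => ?_
  rw [← mem_primaryComponent.mp ht]
  refine J.mul_mem_left _ (Submodule.sum_mem _ fun k _ => Submodule.smul_of_tower_mem _ _ ?_)
  rw [← blockOnes_one_mul]
  have : blockOnes 1 k = blockOnes 1 1 * blockOnes 1 k := (blockOnes_one_mul 1 k).symm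
  rw [this]
  exact J.mul_mem_left _ (J.mul_mem_right _ hone)

end Primary

/-! ### Exponent vectors and characters of (ℤ/p)^m -/

section VectorPowers

variable {p m : ℕ}

/-- The product `b₁ ^ a₁ ⋯ b_m ^ a_m`. -/
def vecPow {H : Type*} [Monoid H] (b : Fin m → H) (a : Fin m → Fin p) : H :=
  (List.ofFn fun j => b j ^ (a j : ℕ)).prod

theorem vecPow_succ {H : Type*} [Monoid H] (b : Fin (m + 1) → H) (a : Fin (m + 1) → Fin p) :
    vecPow b a = b 0 ^ (a 0 : ℕ) * vecPow (fun j => b j.succ) (fun j => a j.succ) := by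
  simp [vecPow, List.ofFn_succ]

theorem vecPow_zero {H : Type*} [Monoid H] [NeZero p] (b : Fin m → H) :
    vecPow b (0 : Fin m → Fin p) = 1 := by
  simp [vecPow]

theorem map_vecPow {H H' : Type*} [Monoid H] [Monoid H'] (f : H →* H') (b : Fin m → H)
    (a : Fin m → Fin p) : f (vecPow b a) = vecPow (fun j => f (b j)) a := by
  simp [vecPow, map_list_prod, List.map_ofFn, Function.comp_def]

/-- Addition in `Fin p` is modulo p, which x^p = 1 makes harmless. -/
theorem pow_fin_add {M : Type*} [Monoid M] [NeZero p] {x : M} (hx : x ^ p = 1) (a a' : Fin p) :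
    x ^ ((a + a' : Fin p) : ℕ) = x ^ (a : ℕ) * x ^ (a' : ℕ) := by
  rw [Fin.val_add, ← pow_eq_pow_mod _ hx, pow_add]

theorem vecPow_add {H : Type*} [Monoid H] [NeZero p] (b : Fin m → H)
    (hc : ∀ i j, Commute (b i) (b j)) (hp : ∀ j, b j ^ p = 1) (a a' : Fin m → Fin p) :
    vecPow b (a + a') = vecPow b a * vecPow b a' := by
  induction m with
  | zero => simp [vecPow]
  | succ m ih =>
    have hcomm : Commute (vecPow (fun j => b j.succ) fun j => a j.succ) (b 0 ^ (a' 0 : ℕ)) := by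
      refine Commute.list_prod_left _ _ fun x hx => ?_
      obtain ⟨j, rfl⟩ := List.mem_ofFn.mp hx
      exact (hc _ _).pow_pow _ _
    rw [vecPow_succ, vecPow_succ, vecPow_succ, Pi.add_apply, pow_fin_add (hp 0)]
    have := ih (fun j => b j.succ) (fun _ _ => hc _ _) (fun _ => hp _) (fun j => a j.succ)
      (fun j => a' j.succ)
    rw [show (fun j : Fin m => (a + a') j.succ) = (fun j => a j.succ) + fun j => a' j.succ from rfl,
      this]
    simp only [mul_assoc]
    rw [← mul_assoc (vecPow _ _) (b 0 ^ (a' 0 : ℕ)), hcomm.eq, mul_assoc]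

theorem vecPow_single {H : Type*} [Monoid H] [NeZero p] (hp : 1 < p) (b : Fin m → H) (j : Fin m) :
    vecPow b (Pi.single j (1 : Fin p)) = b j := by
  induction m with
  | zero => exact j.elim0
  | succ m ih =>
    rw [vecPow_succ]
    refine Fin.cases ?_ (fun j => ?_) j
    · have : (fun i : Fin m => (Pi.single 0 1 : Fin (m + 1) → Fin p) i.succ) = 0 := by
        funext i; simp
      rw [this, vecPow_zero]
      simp [Nat.mod_eq_of_lt hp]
    · have : (fun i : Fin m => (Pi.single j.succ 1 : Fin (m + 1) → Fin p) i.succ) =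
          Pi.single j 1 := by
        funext i
        simp [Pi.single_apply]
      rw [this, ih]
      simp [(Fin.succ_ne_zero j).symm]

/-- The value `ζ ^ (α₁ a₁ + ⋯ + α_m a_m)`. -/
def vecChar (ζ : ℂ) (α a : Fin m → Fin p) : ℂ := ∏ j, ζ ^ ((α j : ℕ) * (a j : ℕ))

theorem vecChar_comm (ζ : ℂ) (α a : Fin m → Fin p) : vecChar ζ α a = vecChar ζ a α :=
  Finset.prod_congr rfl fun _ _ => by rw [mul_comm]

variable [NeZero p] {ζ : ℂ}

theorem vecChar_add (hζ : IsPrimitiveRoot ζ p) (α a a' : Fin m → Fin p) :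
    vecChar ζ α (a + a') = vecChar ζ α a * vecChar ζ α a' := by
  rw [vecChar, vecChar, vecChar, ← Finset.prod_mul_distrib]
  refine Finset.prod_congr rfl fun j _ => ?_
  rw [pow_mul, pow_mul, pow_mul, Pi.add_apply, pow_fin_add]
  rw [← pow_mul, mul_comm, pow_mul, hζ.pow_eq_one, one_pow]

theorem vecChar_zero (ζ : ℂ) (α : Fin m → Fin p) : vecChar ζ α 0 = 1 := by
  simp [vecChar]

theorem vecChar_single (hp : 1 < p) (ζ : ℂ) (α : Fin m → Fin p) (j : Fin m) :
    vecChar ζ α (Pi.single j 1) = ζ ^ (α j : ℕ) := by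
  rw [vecChar, Finset.prod_eq_single j]
  · simp [Nat.mod_eq_of_lt hp]
  · intro i _ hi
    simp [hi]
  · simp

theorem vecChar_injective (hζ : IsPrimitiveRoot ζ p) (hp : 1 < p) {α α' : Fin m → Fin p}
    (h : ∀ a, vecChar ζ α a = vecChar ζ α' a) : α = α' := by
  funext j
  have := h (Pi.single j 1)
  rw [vecChar_single hp, vecChar_single hp] at this
  exact Fin.ext (hζ.pow_inj (α j).2 (α' j).2 this)

theorem exists_vecChar_ne_one (hζ : IsPrimitiveRoot ζ p) (hp : 1 < p) {α : Fin m → Fin p}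
    (hα : α ≠ 0) : ∃ a, vecChar ζ α a ≠ 1 := by
  by_contra! h
  exact hα (vecChar_injective hζ hp fun a => by rw [h, vecChar_comm, vecChar_zero])

/-- Orthogonality: for a ≠ 0, translating α by a suitable b multiplies the sum by a value different
from 1. -/
theorem sum_vecChar (hζ : IsPrimitiveRoot ζ p) (hp : 1 < p) (a : Fin m → Fin p) :
    ∑ α, vecChar ζ α a = if a = 0 then (p : ℂ) ^ m else 0 := by
  split_ifs with ha
  · subst ha
    simp [vecChar_zero]
  · obtain ⟨b, hb⟩ := exists_vecChar_ne_one hζ hp ha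
    have h : ∑ α, vecChar ζ α a = vecChar ζ a b * ∑ α, vecChar ζ α a := by
      rw [Finset.mul_sum, ← Equiv.sum_comp (Equiv.addRight b)]
      refine Finset.sum_congr rfl fun α _ => ?_
      rw [Equiv.coe_addRight, vecChar_comm, vecChar_add hζ, mul_comm, vecChar_comm ζ a α]
    have h2 : (vecChar ζ a b - 1) * ∑ α, vecChar ζ α a = 0 := by
      rw [sub_mul, ← h, one_mul, sub_self]
    exact (mul_eq_zero.mp h2).resolve_left (sub_ne_zero.mpr hb)

theorem exists_fin_ne_zero_iff (α : Fin m → Fin p) : (∃ j, (α j : ℕ) ≠ 0) ↔ α ≠ 0 := by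
  rw [Ne, funext_iff, not_forall]
  exact exists_congr fun j => not_congr (Fin.ext_iff (a := α j) (b := 0)).symm

theorem card_nonzeroVector (p m : ℕ) [NeZero p] : Nat.card (NonzeroVector p m) = p ^ m - 1 := by
  rw [Nat.card_congr (Equiv.subtypeEquivRight exists_fin_ne_zero_iff), Nat.card_eq_fintype_card,
    Fintype.card_subtype_compl]
  simp

end VectorPowers

/-! ### Bases and characters of elementary abelian sections -/

section VectorBasis

variable {G : Type*} [Group G] {p m : ℕ}

/-- The elements `b` of `N` are representatives of a basis of the elementary abelian `p`-group
`N / K`. -/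
structure IsVecBasis (p : ℕ) [NeZero p] (N K : Subgroup G) [K.Normal] (b : Fin m → G) : Prop where
  le : K ≤ N
  mem : ∀ a : Fin m → Fin p, vecPow b a ∈ N
  exists_eq : ∀ v ∈ N, ∃ a : Fin m → Fin p, ((vecPow b a : G) : G ⧸ K) = v
  inj : ∀ a a' : Fin m → Fin p, ((vecPow b a : G) : G ⧸ K) = (vecPow b a' : G) → a = a'
  add : ∀ a a' : Fin m → Fin p, ((vecPow b (a + a') : G) : G ⧸ K) =
    (vecPow b a : G) * (vecPow b a' : G)
  comm : ∀ u ∈ N, ∀ v ∈ N, (u * v : G ⧸ K) = v * u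

/-- The b_j generate N/K, so exponent vectors map onto it, and |N/K| = p^m makes this homomorphism
bijective. -/
theorem IsVecBasis.of_closure [Finite G] [NeZero p] (hp : 1 < p) {N K : Subgroup G} [K.Normal]
    {b : Fin m → G} (hle : K ≤ N) (hb : ∀ j, b j ∈ N)
    (hcomm : ∀ u ∈ N, ∀ v ∈ N, (u * v : G ⧸ K) = v * u)
    (hpow : ∀ v ∈ N, v ^ p ∈ K)
    (hcl : Subgroup.closure (Set.range fun j => (b j : G ⧸ K)) = N.map (QuotientGroup.mk' K))
    (hcard : Nat.card (N.map (QuotientGroup.mk' K)) = p ^ m) : IsVecBasis p N K b := by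
  have hmk : ∀ a : Fin m → Fin p, ((vecPow b a : G) : G ⧸ K) = vecPow (fun j => (b j : G ⧸ K)) a :=
    fun a => map_vecPow (QuotientGroup.mk' K) b a
  let θ : Multiplicative (Fin m → Fin p) →* G ⧸ K :=
    MonoidHom.mk' (fun a => vecPow (fun j => (b j : G ⧸ K)) a.toAdd) fun a a' =>
      vecPow_add _ (fun i j => hcomm _ (hb i) _ (hb j))
        (fun j => (QuotientGroup.eq_one_iff _).mpr (hpow _ (hb j))) _ _
  have hrange : θ.range = N.map (QuotientGroup.mk' K) := by
    apply le_antisymm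
    · rintro _ ⟨a, rfl⟩
      refine Subgroup.list_prod_mem _ fun x hx => ?_
      obtain ⟨j, rfl⟩ := List.mem_ofFn.mp hx
      exact Subgroup.pow_mem _ (Subgroup.mem_map_of_mem (QuotientGroup.mk' K) (hb j)) _
    · rw [← hcl, Subgroup.closure_le]
      rintro _ ⟨j, rfl⟩
      exact ⟨Multiplicative.ofAdd (Pi.single j 1), vecPow_single hp _ j⟩
  have hinj : Function.Injective θ := by
    have hb := θ.rangeRestrict_surjective.bijective_of_nat_card_le (by
      rw [hrange, hcard]
      simp [Nat.card_eq_fintype_card])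
    intro a a' h
    exact hb.1 (Subtype.ext h)
  refine ⟨hle, fun a => ?_, fun v hv => ?_, fun a a' h => ?_, fun a a' => ?_, hcomm⟩
  · refine Subgroup.list_prod_mem _ fun x hx => ?_
    obtain ⟨j, rfl⟩ := List.mem_ofFn.mp hx
    exact Subgroup.pow_mem _ (hb j) _
  · have : (v : G ⧸ K) ∈ θ.range := by
      rw [hrange]; exact ⟨v, hv, rfl⟩
    obtain ⟨a, ha⟩ := this
    exact ⟨a.toAdd, (hmk _).trans ha⟩
  · rw [hmk, hmk] at h
    exact Multiplicative.ofAdd.injective (hinj (a₁ := Multiplicative.ofAdd a) h)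
  · rw [hmk, hmk, hmk]
    exact map_mul θ (Multiplicative.ofAdd a) (Multiplicative.ofAdd a')

open scoped Classical

/-- The function on `G` that is the character `α` of `N / K` on `N` and vanishes outside `N`. -/
noncomputable def charFun (K : Subgroup G) (b : Fin m → G) (ζ : ℂ) (α : Fin m → Fin p) (v : G) :
    ℂ :=
  ∑ a : Fin m → Fin p, vecChar ζ α a * if ((vecPow b a : G) : G ⧸ K) = v then 1 else 0

namespace IsVecBasis

variable [NeZero p] {N K : Subgroup G} [K.Normal] {b : Fin m → G} {ζ : ℂ}

theorem charFun_of_eq (h : IsVecBasis p N K b) {α a : Fin m → Fin p} {v : G}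
    (hv : ((vecPow b a : G) : G ⧸ K) = v) : charFun K b ζ α v = vecChar ζ α a := by
  rw [charFun, Finset.sum_eq_single a]
  · rw [if_pos hv, mul_one]
  · intro a' _ ha'
    rw [if_neg, mul_zero]
    intro h'
    exact ha' (h.inj _ _ (h'.trans hv.symm))
  · simp

theorem mem_of_eq (h : IsVecBasis p N K b) {u v : G} (hu : u ∈ N) (huv : (u : G ⧸ K) = v) :
    v ∈ N := by
  have := N.mul_mem hu (h.le (QuotientGroup.eq.mp huv))
  simpa using this

theorem charFun_of_notMem (h : IsVecBasis p N K b) {α : Fin m → Fin p} {v : G} (hv : v ∉ N) :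
    charFun K b ζ α v = 0 := by
  refine Finset.sum_eq_zero fun a _ => ?_
  rw [if_neg, mul_zero]
  exact fun h' => hv (h.mem_of_eq (h.mem a) h')

theorem charFun_mul (h : IsVecBasis p N K b) (hζ : IsPrimitiveRoot ζ p) {α : Fin m → Fin p} {v : G}
    (hv : v ∈ N) (w : G) :
    charFun K b ζ α (v * w) = charFun K b ζ α v * charFun K b ζ α w := by
  by_cases hw : w ∈ N
  · obtain ⟨a, ha⟩ := h.exists_eq v hv
    obtain ⟨a', ha'⟩ := h.exists_eq w hw
    rw [h.charFun_of_eq ha, h.charFun_of_eq ha', h.charFun_of_eq (a := a + a'), vecChar_add hζ]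
    rw [h.add, ha, ha']; rfl
  · rw [h.charFun_of_notMem hw, h.charFun_of_notMem (fun h' => hw ((N.mul_mem_cancel_left hv).mp h')),
      mul_zero]

theorem charFun_of_mem (h : IsVecBasis p N K b) {α : Fin m → Fin p} {v : G} (hv : v ∈ K) :
    charFun K b ζ α v = 1 := by
  rw [h.charFun_of_eq (a := 0), vecChar_zero]
  rw [vecPow_zero]
  exact ((QuotientGroup.eq_one_iff v).mpr hv).symm

theorem charFun_zero (h : IsVecBasis p N K b) {v : G} (hv : v ∈ N) :
    charFun K b ζ (0 : Fin m → Fin p) v = 1 := by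
  obtain ⟨a, ha⟩ := h.exists_eq v hv
  rw [h.charFun_of_eq ha, vecChar_comm, vecChar_zero]

theorem exists_charFun_ne_one (h : IsVecBasis p N K b) (hζ : IsPrimitiveRoot ζ p) (hp : 1 < p)
    {α : Fin m → Fin p} (hα : α ≠ 0) : ∃ v ∈ N, charFun K b ζ α v ≠ 1 := by
  obtain ⟨a, ha⟩ := exists_vecChar_ne_one hζ hp hα
  exact ⟨vecPow b a, h.mem a, by rwa [h.charFun_of_eq rfl]⟩

theorem charFun_injective (h : IsVecBasis p N K b) (hζ : IsPrimitiveRoot ζ p) (hp : 1 < p)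
    {α α' : Fin m → Fin p} (hα : ∀ v ∈ N, charFun K b ζ α v = charFun K b ζ α' v) : α = α' :=
  vecChar_injective hζ hp fun a => by
    rw [← h.charFun_of_eq (v := vecPow b a) rfl, hα _ (h.mem a), h.charFun_of_eq rfl]

theorem sum_charFun (h : IsVecBasis p N K b) (hζ : IsPrimitiveRoot ζ p) (hp : 1 < p) (v : G) :
    ∑ α : Fin m → Fin p, charFun K b ζ α v = if v ∈ K then (p : ℂ) ^ m else 0 := by
  by_cases hv : v ∈ N
  · obtain ⟨a, ha⟩ := h.exists_eq v hv
    simp only [h.charFun_of_eq ha]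
    rw [sum_vecChar hζ hp]
    refine if_congr ?_ rfl rfl
    rw [← QuotientGroup.eq_one_iff, ← ha]
    constructor
    · rintro rfl
      rw [vecPow_zero]; rfl
    · intro h1
      exact h.inj _ _ (by rw [h1, vecPow_zero]; rfl)
  · rw [if_neg (fun h' => hv (h.le h')), Finset.sum_eq_zero]
    exact fun α _ => h.charFun_of_notMem hv

end IsVecBasis

end VectorBasis

/-! ### Character kernels on a conjugacy class -/

section ClassKernels

open scoped Classical

variable {G : Type*} [Group G]

theorem conjClasses_mk_mul_comm (x y : G) : ConjClasses.mk (x * y) = ConjClasses.mk (y * x) := by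
  rw [← conjClasses_mk_conj y (x * y)]
  congr 1
  group

/-- The matrix with entries `f (y x⁻¹)` in the `c, c` block and `0` elsewhere. -/
noncomputable def classKernel (c : ConjClasses G) (f : G → ℂ) : Matrix G G ℂ :=
  of fun x y => if ConjClasses.mk x = c ∧ ConjClasses.mk y = c then f (y * x⁻¹) else 0

theorem classKernel_apply (c : ConjClasses G) (f : G → ℂ) (x y : G) :
    classKernel c f x y =
      if ConjClasses.mk x = c ∧ ConjClasses.mk y = c then f (y * x⁻¹) else 0 := rfl

theorem smul_classKernel (c : ConjClasses G) (r : ℂ) (f : G → ℂ) :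
    r • classKernel c f = classKernel c fun v => r * f v := by
  ext x y
  simp only [Matrix.smul_apply, classKernel_apply, smul_eq_mul, mul_ite, mul_zero]

theorem sum_classKernel {ι : Type*} (s : Finset ι) (c : ConjClasses G) (f : ι → G → ℂ) :
    ∑ i ∈ s, classKernel c (f i) = classKernel c fun v => ∑ i ∈ s, f i v := by
  ext x y
  rw [Matrix.sum_apply]
  simp only [classKernel_apply]
  split_ifs <;> simp

variable {N : Subgroup G} {c : ConjClasses G} {f : G → ℂ}

/-- A nontrivial one-dimensional character of `N`, extended by zero. -/
structure IsKernelChar (N : Subgroup G) (f : G → ℂ) : Prop where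
  zero_of_notMem : ∀ v ∉ N, f v = 0
  mul : ∀ v ∈ N, ∀ w, f (v * w) = f v * f w
  one : f 1 = 1
  nontrivial : ∃ v ∈ N, f v ≠ 1

theorem IsVecBasis.isKernelChar {p m : ℕ} [NeZero p] {K : Subgroup G} [K.Normal] {b : Fin m → G}
    {ζ : ℂ} (h : IsVecBasis p N K b) (hζ : IsPrimitiveRoot ζ p) (hp : 1 < p) {α : Fin m → Fin p}
    (hα : α ≠ 0) : IsKernelChar N (charFun K b ζ α) where
  zero_of_notMem _ hv := h.charFun_of_notMem hv
  mul _ hv w := h.charFun_mul hζ hv w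
  one := h.charFun_of_mem (one_mem K)
  nontrivial := h.exists_charFun_ne_one hζ hp hα

theorem IsKernelChar.sum_eq_zero [Fintype G] (hf : IsKernelChar N f) : ∑ u, f u = 0 := by
  obtain ⟨v, hv, hv1⟩ := hf.nontrivial
  have h : ∑ u, f u = f v * ∑ u, f u := by
    rw [Finset.mul_sum, ← Equiv.sum_comp (Equiv.mulLeft v)]
    exact Finset.sum_congr rfl fun u _ => hf.mul v hv u
  have h2 : (f v - 1) * ∑ u, f u = 0 := by rw [sub_mul, ← h, one_mul, sub_self]
  exact (mul_eq_zero.mp h2).resolve_left (sub_ne_zero.mpr hv1)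

variable [Fintype G] [DecidableEq G]

/-- The convolution of f with the indicator of the class j is a multiple of f. For v ∈ N,
translation by v pulls out f v. For v ∉ N, the indicator is constant on N-cosets outside N, so
replacing u by n u multiplies the sum by f n, and some f n ≠ 1. -/
theorem IsKernelChar.sum_mul_eq [N.Normal] (hf : IsKernelChar N f)
    (hN : ∀ v ∉ N, ∀ u ∈ N, ConjClasses.mk (u * v) = ConjClasses.mk v) (j : ConjClasses G) (v : G) :
    ∑ u, (if ConjClasses.mk (u⁻¹ * v) = j then f u else 0) =
      (∑ u, if ConjClasses.mk u⁻¹ = j then f u else 0) * f v := by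
  by_cases hv : v ∈ N
  · rw [Finset.sum_mul, ← Equiv.sum_comp (Equiv.mulLeft v)]
    refine Finset.sum_congr rfl fun u _ => ?_
    rw [Equiv.coe_mulLeft, _root_.mul_inv_rev, inv_mul_cancel_right, hf.mul v hv, ite_mul, zero_mul,
      mul_comm]
  · rw [hf.zero_of_notMem v hv, mul_zero]
    obtain ⟨n, hn, hn1⟩ := hf.nontrivial
    have h : ∑ u, (if ConjClasses.mk (u⁻¹ * v) = j then f u else 0) =
        f n * ∑ u, (if ConjClasses.mk (u⁻¹ * v) = j then f u else 0) := by
      rw [Finset.mul_sum]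
      conv_lhs => rw [← Equiv.sum_comp (Equiv.mulLeft n)]
      refine Finset.sum_congr rfl fun u _ => ?_
      rw [Equiv.coe_mulLeft, hf.mul n hn, mul_ite, mul_zero]
      by_cases hu : u ∈ N
      · refine if_congr ?_ rfl rfl
        have h1 : (n * u)⁻¹ * v = (u⁻¹ * n⁻¹ * u⁻¹⁻¹) * (u⁻¹ * v) := by group
        rw [h1, hN _ (fun h' => hv ((N.mul_mem_cancel_left (inv_mem hu)).mp h')) _
          (‹N.Normal›.conj_mem _ (inv_mem hn) _)]
      · rw [hf.zero_of_notMem u hu, mul_zero, ite_self, ite_self]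
    have h2 : (f n - 1) * ∑ u, (if ConjClasses.mk (u⁻¹ * v) = j then f u else 0) = 0 := by
      rw [sub_mul, ← h, one_mul, sub_self]
    exact (mul_eq_zero.mp h2).resolve_left (sub_ne_zero.mpr hn1)

theorem dualIdempotent_mul_classKernel (c c' : ConjClasses G) (f : G → ℂ) :
    dualIdempotent c' * classKernel c f = (if c' = c then (1 : ℂ) else 0) • classKernel c f := by
  ext x y
  rw [dualIdempotent_mul_apply, Matrix.smul_apply, classKernel_apply]
  by_cases h1 : ConjClasses.mk x = c <;> by_cases h2 : ConjClasses.mk x = c' <;> aesop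

theorem classKernel_mul_dualIdempotent (c c' : ConjClasses G) (f : G → ℂ) :
    classKernel c f * dualIdempotent c' = (if c' = c then (1 : ℂ) else 0) • classKernel c f := by
  ext x y
  rw [mul_dualIdempotent_apply, Matrix.smul_apply, classKernel_apply]
  by_cases h1 : ConjClasses.mk y = c <;> by_cases h2 : ConjClasses.mk y = c' <;> aesop

/-- With f supported on N and c stable under left translation by N, the middle point y = u x never
leaves the block, so the product is a plain convolution. -/
theorem classKernel_mul (hc : ∀ u ∈ N, ∀ x, ConjClasses.mk x = c → ConjClasses.mk (u * x) = c)
    (hf : ∀ v ∉ N, f v = 0) (h : G → ℂ) :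
    classKernel c f * classKernel c h = classKernel c fun v => ∑ u, f u * h (v * u⁻¹) := by
  ext x z
  rw [Matrix.mul_apply, ← Equiv.sum_comp (Equiv.mulRight x), classKernel_apply]
  by_cases hxz : ConjClasses.mk x = c ∧ ConjClasses.mk z = c
  · rw [if_pos hxz]
    refine Finset.sum_congr rfl fun u _ => ?_
    rw [Equiv.coe_mulRight, classKernel_apply, classKernel_apply]
    by_cases hu : u ∈ N
    · rw [if_pos ⟨hxz.1, hc u hu x hxz.1⟩, if_pos ⟨hc u hu x hxz.1, hxz.2⟩]
      simp [mul_assoc]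
    · simp [hf u hu]
  · rw [if_neg hxz]
    refine Finset.sum_eq_zero fun u _ => ?_
    rw [classKernel_apply, classKernel_apply]
    by_cases hx : ConjClasses.mk x = c
    · rw [if_neg (fun h' : _ ∧ ConjClasses.mk z = c => hxz ⟨hx, h'.2⟩), mul_zero]
    · rw [if_neg (fun h' : ConjClasses.mk x = c ∧ _ => hx h'.1), zero_mul]

namespace IsKernelChar

theorem adjMatrix_mul [N.Normal] (hf : IsKernelChar N f)
    (hc : ∀ u ∈ N, ∀ x, ConjClasses.mk x = c → ConjClasses.mk (u * x) = c)
    (hN : ∀ v ∉ N, ∀ u ∈ N, ConjClasses.mk (u * v) = ConjClasses.mk v) (j : ConjClasses G) :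
    adjMatrix j * classKernel c f =
      (∑ u, if ConjClasses.mk u⁻¹ = j then f u else 0) • classKernel c f := by
  ext x z
  rw [Matrix.mul_apply, Matrix.smul_apply, smul_eq_mul, classKernel_apply]
  have h1 : ∑ y, adjMatrix j x y * classKernel c f y z =
      if ConjClasses.mk z = c then
        ∑ u, (if ConjClasses.mk (u⁻¹ * (z * x⁻¹)) = j then f u else 0) else 0 := by
    -- The substitution y = u⁻¹z makes the argument of f equal to u.
    rw [← Equiv.sum_comp ((Equiv.inv G).trans (Equiv.mulRight z))]
    split_ifs with hz
    · refine Finset.sum_congr rfl fun u _ => ?_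
      simp only [Equiv.trans_apply, Equiv.inv_apply, Equiv.coe_mulRight]
      rw [adjMatrix_apply, classKernel_apply]
      by_cases hu : u ∈ N
      · rw [if_pos (show ConjClasses.mk (u⁻¹ * z) = c ∧ _ from ⟨hc _ (inv_mem hu) z hz, hz⟩)]
        simp [mul_assoc]
      · simp [hf.zero_of_notMem u hu]
    · refine Finset.sum_eq_zero fun u _ => ?_
      rw [classKernel_apply, if_neg (fun h' => hz h'.2), mul_zero]
  rw [h1]
  split_ifs with hz hxz hxz
  · rw [hf.sum_mul_eq hN]
  · rw [hf.sum_mul_eq hN, hf.zero_of_notMem, mul_zero]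
    intro hmem
    refine hxz ⟨?_, hz⟩
    have := hc _ (inv_mem hmem) z hz
    simpa using this
  · exact absurd hxz.2 hz
  · simp

theorem mul_adjMatrix [N.Normal] (hf : IsKernelChar N f)
    (hc : ∀ u ∈ N, ∀ x, ConjClasses.mk x = c → ConjClasses.mk (u * x) = c)
    (hN : ∀ v ∉ N, ∀ u ∈ N, ConjClasses.mk (u * v) = ConjClasses.mk v) (j : ConjClasses G) :
    classKernel c f * adjMatrix j =
      (∑ u, if ConjClasses.mk u⁻¹ = j then f u else 0) • classKernel c f := by
  ext x z
  rw [Matrix.mul_apply, Matrix.smul_apply, smul_eq_mul, classKernel_apply]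
  have h1 : ∑ y, classKernel c f x y * adjMatrix j y z =
      if ConjClasses.mk x = c then
        ∑ u, (if ConjClasses.mk (u⁻¹ * (z * x⁻¹)) = j then f u else 0) else 0 := by
    rw [← Equiv.sum_comp (Equiv.mulRight x)]
    split_ifs with hx
    · refine Finset.sum_congr rfl fun u _ => ?_
      rw [Equiv.coe_mulRight, adjMatrix_apply, classKernel_apply]
      by_cases hu : u ∈ N
      · rw [if_pos ⟨hx, hc _ hu x hx⟩, conjClasses_mk_mul_comm u⁻¹]
        simp [mul_assoc]
      · simp [hf.zero_of_notMem u hu]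
    · refine Finset.sum_eq_zero fun u _ => ?_
      rw [classKernel_apply, if_neg (fun h' => hx h'.1), zero_mul]
  rw [h1]
  split_ifs with hx hxz hxz
  · rw [hf.sum_mul_eq hN]
  · rw [hf.sum_mul_eq hN, hf.zero_of_notMem, mul_zero]
    intro hmem
    refine hxz ⟨hx, ?_⟩
    have := hc _ hmem x hx
    simpa using this
  · exact absurd hxz.1 hx
  · simp

theorem classKernel_mul_self (hf : IsKernelChar N f)
    (hc : ∀ u ∈ N, ∀ x, ConjClasses.mk x = c → ConjClasses.mk (u * x) = c) :
    classKernel c f * classKernel c f = (Nat.card N : ℂ) • classKernel c f := by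
  rw [classKernel_mul hc hf.zero_of_notMem, smul_classKernel]
  congr 1
  funext v
  have hu : ∀ u, f u * f (v * u⁻¹) = if u ∈ N then f v else 0 := by
    intro u
    split_ifs with hu
    · by_cases hv : v ∈ N
      · have h1 : f u * f u⁻¹ = 1 := by rw [← hf.mul u hu, mul_inv_cancel, hf.one]
        rw [hf.mul v hv]
        linear_combination f v * h1
      · rw [hf.zero_of_notMem v hv, hf.zero_of_notMem (v * u⁻¹), mul_zero]
        exact fun h' => hv ((N.mul_mem_cancel_right (inv_mem hu)).mp h')
    · rw [hf.zero_of_notMem u hu, zero_mul]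
  simp only [hu]
  rw [← Finset.sum_filter, Finset.sum_const, nsmul_eq_mul, Nat.card_eq_fintype_card,
    Fintype.card_subtype]

/-- The normalized kernel of a nontrivial character is a scalar idempotent of `T(G)`. -/
theorem isScalarIdempotent [N.Normal] (hf : IsKernelChar N f)
    (hc : ∀ u ∈ N, ∀ x, ConjClasses.mk x = c → ConjClasses.mk (u * x) = c)
    (hN : ∀ v ∉ N, ∀ u ∈ N, ConjClasses.mk (u * v) = ConjClasses.mk v)
    {e : terwilligerAlgebra G}
    (he : (e : Matrix G G ℂ) = (Nat.card N : ℂ)⁻¹ • classKernel c f) : IsScalarIdempotent e := by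
  have hcard : (Nat.card N : ℂ) ≠ 0 := Nat.cast_ne_zero.mpr Nat.card_pos.ne'
  have hscalar : ∀ t : terwilligerAlgebra G, ∃ r s : ℂ,
      (t : Matrix G G ℂ) * classKernel c f = r • classKernel c f ∧
      classKernel c f * (t : Matrix G G ℂ) = s • classKernel c f := by
    rintro ⟨t, ht⟩
    change ∃ r s : ℂ, t * _ = _ ∧ _ * t = _
    induction ht using Algebra.adjoin_induction with
    | mem t ht =>
      rcases ht with ⟨j, rfl⟩ | ⟨j, rfl⟩
      · exact ⟨_, _, hf.adjMatrix_mul hc hN j, hf.mul_adjMatrix hc hN j⟩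
      · exact ⟨_, _, dualIdempotent_mul_classKernel c j f, classKernel_mul_dualIdempotent c j f⟩
    | algebraMap r =>
      refine ⟨r, r, ?_, ?_⟩ <;> simp [Algebra.algebraMap_eq_smul_one]
    | add s t _ _ hs ht =>
      obtain ⟨r, r', h1, h2⟩ := hs
      obtain ⟨q, q', h3, h4⟩ := ht
      exact ⟨r + q, r' + q', by rw [add_mul, h1, h3, add_smul], by rw [mul_add, h2, h4, add_smul]⟩
    | mul s t _ _ hs ht =>
      obtain ⟨r, r', h1, h2⟩ := hs
      obtain ⟨q, q', h3, h4⟩ := ht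
      refine ⟨q * r, r' * q', ?_, ?_⟩
      · rw [mul_assoc, h3, mul_smul_comm, h1, smul_smul]
      · rw [← mul_assoc, h2, smul_mul_assoc, h4, smul_smul]
  refine ⟨?_, ?_, fun t => ?_, fun t => ?_⟩
  · rintro rfl
    obtain ⟨x, rfl⟩ := ConjClasses.mk_surjective c
    have h1 := congrFun (congrFun he x) x
    rw [Matrix.smul_apply, classKernel_apply, if_pos ⟨rfl, rfl⟩, mul_inv_cancel, hf.one,
      smul_eq_mul, mul_one] at h1
    exact inv_ne_zero hcard h1.symm
  · refine Subtype.ext ?_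
    rw [MulMemClass.coe_mul, he, smul_mul_smul_comm, hf.classKernel_mul_self hc, smul_smul]
    congr 1
    field_simp
  · obtain ⟨r, -, h, -⟩ := hscalar t
    refine ⟨r, Subtype.ext ?_⟩
    rw [MulMemClass.coe_mul, SetLike.val_smul, he, mul_smul_comm, h, smul_comm]
  · obtain ⟨-, r, -, h⟩ := hscalar t
    refine ⟨r, Subtype.ext ?_⟩
    rw [MulMemClass.coe_mul, SetLike.val_smul, he, smul_mul_assoc, h, smul_comm]

/-- The average does not change when its row index moves within c, so the sum of f over N, which is
0, factors out. -/
theorem mul_primaryIdem (hf : IsKernelChar N f)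
    (hc : ∀ u ∈ N, ∀ x, ConjClasses.mk x = c → ConjClasses.mk (u * x) = c)
    {e : terwilligerAlgebra G}
    (he : (e : Matrix G G ℂ) = (Nat.card N : ℂ)⁻¹ • classKernel c f) : e * primaryIdem G = 0 := by
  refine Subtype.ext ?_
  rw [MulMemClass.coe_mul, he, coe_primaryIdem, smul_mul_assoc]
  have : classKernel c f * conjAverage G = 0 := by
    ext x z
    rw [Matrix.mul_apply, ← Equiv.sum_comp (Equiv.mulRight x)]
    by_cases hx : ConjClasses.mk x = c
    · have : ∀ u, classKernel c f x (u * x) * conjAverage G (u * x) z =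
          f u * conjAverage G x z := by
        intro u
        by_cases hu : u ∈ N
        · rw [classKernel_apply, if_pos ⟨hx, hc u hu x hx⟩, mul_inv_cancel_right,
            apply_eq_of_mk_eq (f := fun w => conjAverage G w z)
              (fun g w => conjAverage_conj_left g w z) ((hc u hu x hx).trans hx.symm)]
        · rw [classKernel_apply, mul_inv_cancel_right, hf.zero_of_notMem u hu, ite_self]
          simp
      simp only [Equiv.coe_mulRight, this]
      rw [← Finset.sum_mul, hf.sum_eq_zero, zero_mul]
      rfl
    · refine Finset.sum_eq_zero fun u _ => ?_
      rw [classKernel_apply, if_neg (fun h' => hx h'.1), zero_mul]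
  rw [this, smul_zero]
  rfl

end IsKernelChar

end ClassKernels

/-! ### Block translations by cosets -/

section BlockTranslations

open scoped Classical

variable {G : Type*} [Group G]

/-- The normalized matrix of the relation `y x⁻¹ ∈ u K` in the `c, c` block. -/
noncomputable def blockTrans (c : ConjClasses G) (K : Subgroup G) (u : G) : Matrix G G ℂ :=
  (Nat.card K : ℂ)⁻¹ • classKernel c fun v => if (u : G ⧸ K) = v then 1 else 0

theorem sum_vecChar_smul_blockTrans {p m : ℕ} (c : ConjClasses G) (K : Subgroup G) (b : Fin m → G)
    (ζ : ℂ) (α : Fin m → Fin p) :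
    ∑ a : Fin m → Fin p, vecChar ζ α a • blockTrans c K (vecPow b a) =
      (Nat.card K : ℂ)⁻¹ • classKernel c (charFun K b ζ α) := by
  simp only [blockTrans, smul_classKernel, sum_classKernel, charFun, Finset.mul_sum]
  congr 1
  funext v
  exact Finset.sum_congr rfl fun a _ => by ring

theorem conjClasses_mk_eq_iff_of_mem_center {z v : G} (hz : z ∈ Subgroup.center G) :
    ConjClasses.mk v = ConjClasses.mk z ↔ v = z := by
  rw [ConjClasses.mk_eq_mk_iff_isConj]
  constructor
  · intro h
    obtain ⟨g, hg⟩ := isConj_iff.mp h.symm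
    rw [← hg, Subgroup.mem_center_iff.mp hz g]
    group
  · rintro rfl
    exact IsConj.refl _

variable [Fintype G] [DecidableEq G] {N K : Subgroup G} {c : ConjClasses G}

theorem dualIdempotent_mul_self : dualIdempotent c * dualIdempotent c = dualIdempotent c := by
  ext x y
  rw [dualIdempotent_mul_apply, dualIdempotent_eq, diagonal_apply]
  split_ifs <;> rfl

theorem dualIdempotent_mul_blockTrans (u : G) :
    dualIdempotent c * blockTrans c K u = blockTrans c K u := by
  rw [blockTrans, mul_smul_comm, dualIdempotent_mul_classKernel, if_pos rfl, one_smul]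

theorem blockTrans_mul_dualIdempotent (u : G) :
    blockTrans c K u * dualIdempotent c = blockTrans c K u := by
  rw [blockTrans, smul_mul_assoc, classKernel_mul_dualIdempotent, if_pos rfl, one_smul]

theorem blockTrans_bot_one : blockTrans c (⊥ : Subgroup G) 1 = dualIdempotent c := by
  ext x y
  rw [dualIdempotent_eq, blockTrans, Subgroup.card_bot, Nat.cast_one, inv_one, one_smul,
    classKernel_apply, diagonal_apply]
  have h : ((1 : G) : G ⧸ (⊥ : Subgroup G)) = ((y * x⁻¹ : G) : G ⧸ (⊥ : Subgroup G)) ↔ x = y := by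
    rw [QuotientGroup.eq, Subgroup.mem_bot, inv_one, one_mul, mul_inv_eq_one, eq_comm]
  simp only [h]
  by_cases hxy : x = y
  · subst hxy; simp
  · simp [hxy]

theorem coe_blockAdj (b : G) : (blockAdj c (ConjClasses.mk b) : Matrix G G ℂ) =
    classKernel c fun v => if ConjClasses.mk v = ConjClasses.mk b then 1 else 0 := by
  ext x y
  change (dualIdempotent c * adjMatrix (ConjClasses.mk b) * dualIdempotent c) x y = _
  rw [mul_dualIdempotent_apply, dualIdempotent_mul_apply, adjMatrix_apply, classKernel_apply]
  by_cases hx : ConjClasses.mk x = c <;> by_cases hy : ConjClasses.mk y = c <;> simp [hx, hy]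

theorem coe_blockAdj_eq_blockTrans {b : G}
    (hb : ∀ v, ConjClasses.mk v = ConjClasses.mk b ↔ (b : G ⧸ K) = v) :
    (blockAdj c (ConjClasses.mk b) : Matrix G G ℂ) = (Nat.card K : ℂ) • blockTrans c K b := by
  have hcard : (Nat.card K : ℂ) ≠ 0 := Nat.cast_ne_zero.mpr Nat.card_pos.ne'
  rw [coe_blockAdj, blockTrans, smul_smul, mul_inv_cancel₀ hcard, one_smul]
  simp only [hb]

variable [K.Normal]

/-- Each nonzero entry of the product receives |K| middle points, and the normalization by |K| turns
this into exact multiplicativity in u. -/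
theorem blockTrans_mul (hKN : K ≤ N)
    (hc : ∀ u ∈ N, ∀ x, ConjClasses.mk x = c → ConjClasses.mk (u * x) = c) {u w : G} (hu : u ∈ N)
    (hcomm : (u * w : G ⧸ K) = w * u) :
    blockTrans c K u * blockTrans c K w = blockTrans c K (u * w) := by
  have hcard : (Nat.card K : ℂ) ≠ 0 := Nat.cast_ne_zero.mpr Nat.card_pos.ne'
  rw [blockTrans, blockTrans, blockTrans, smul_mul_smul_comm, classKernel_mul hc]
  · rw [smul_classKernel, smul_classKernel]
    congr 1
    funext v
    have h : ∀ t : G, ((if (u : G ⧸ K) = t then 1 else 0 : ℂ) *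
        if (w : G ⧸ K) = ((v * t⁻¹ : G) : G ⧸ K) then 1 else 0) =
        (if ((u * w : G) : G ⧸ K) = v then 1 else 0) * if u⁻¹ * t ∈ K then 1 else 0 := by
      intro t
      rw [← QuotientGroup.eq]
      by_cases ht : (u : G ⧸ K) = t
      · have : (w : G ⧸ K) = ((v * t⁻¹ : G) : G ⧸ K) ↔ ((u * w : G) : G ⧸ K) = v := by
          rw [QuotientGroup.mk_mul, QuotientGroup.mk_inv, ← ht, QuotientGroup.mk_mul, hcomm,
            eq_mul_inv_iff_mul_eq]
        rw [if_pos ht, if_pos ht, one_mul, mul_one]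
        exact if_congr this rfl rfl
      · rw [if_neg ht, if_neg ht, zero_mul, mul_zero]
    simp only [h]
    rw [← Finset.mul_sum, Fintype.sum_equiv (Equiv.mulLeft u⁻¹)
      (fun t => if u⁻¹ * t ∈ K then (1 : ℂ) else 0) (fun t => if t ∈ K then (1 : ℂ) else 0)
      (fun t => rfl), ← Finset.sum_filter, Finset.sum_const, nsmul_eq_mul, mul_one,
      Nat.card_eq_fintype_card, Fintype.card_subtype]
    rw [Nat.card_eq_fintype_card, Fintype.card_subtype] at hcard
    field_simp
  · intro v hv
    rw [if_neg]
    intro h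
    have := N.mul_mem hu (hKN (QuotientGroup.eq.mp h))
    exact hv (by simpa using this)

theorem blockTrans_pow (hKN : K ≤ N)
    (hc : ∀ u ∈ N, ∀ x, ConjClasses.mk x = c → ConjClasses.mk (u * x) = c) {u : G} (hu : u ∈ N)
    {a : ℕ} (ha : a ≠ 0) : blockTrans c K u ^ a = blockTrans c K (u ^ a) := by
  obtain ⟨a, rfl⟩ := Nat.exists_eq_succ_of_ne_zero ha
  clear ha
  induction a with
  | zero => simp
  | succ a ih =>
    rw [pow_succ, ih, blockTrans_mul hKN hc (pow_mem hu _), ← pow_succ]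
    rw [← QuotientGroup.mk_mul, ← QuotientGroup.mk_mul, ← pow_succ, ← pow_succ']

/-- Dividing by |K|^a turns a power of the block adjacency matrix into a block translation. Exponent
0 stays apart: it gives E_c^*, whereas `blockTrans c K 1` averages over K. -/
theorem smul_blockPow (hKN : K ≤ N)
    (hc : ∀ u ∈ N, ∀ x, ConjClasses.mk x = c → ConjClasses.mk (u * x) = c) {b : G} (hbN : b ∈ N)
    (hb : ∀ v, ConjClasses.mk v = ConjClasses.mk b ↔ (b : G ⧸ K) = v) (r : ℂ) (a : ℕ) :
    (((r / (Nat.card K : ℂ) ^ a) • blockPow c (ConjClasses.mk b) a : terwilligerAlgebra G) :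
      Matrix G G ℂ) = r • if a = 0 then dualIdempotent c else blockTrans c K (b ^ a) := by
  have hcard : (Nat.card K : ℂ) ≠ 0 := Nat.cast_ne_zero.mpr Nat.card_pos.ne'
  rw [SetLike.val_smul, blockPow]
  split_ifs with ha
  · subst ha
    rw [pow_zero, div_one]
    rfl
  · rw [SubmonoidClass.coe_pow, coe_blockAdj_eq_blockTrans hb, smul_pow, smul_smul,
      blockTrans_pow hKN hc hbN ha, div_mul_cancel₀ _ (pow_ne_zero _ hcard)]

/-- The products of block powers in the definitions of the idempotents. -/
theorem dualIdempotent_mul_prod_blockPow (hKN : K ≤ N)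
    (hc : ∀ u ∈ N, ∀ x, ConjClasses.mk x = c → ConjClasses.mk (u * x) = c)
    (hcomm : ∀ u ∈ N, ∀ v ∈ N, (u * v : G ⧸ K) = v * u) {p m : ℕ} [NeZero p]
    (b : Fin m → G) (hbN : ∀ j, b j ∈ N)
    (hb : ∀ j v, ConjClasses.mk v = ConjClasses.mk (b j) ↔ (b j : G ⧸ K) = v) (ζ : ℂ)
    (α a : Fin m → Fin p) :
    dualIdempotent c * (((List.ofFn fun j : Fin m =>
      (ζ ^ ((α j : ℕ) * (a j : ℕ)) / (Nat.card K : ℂ) ^ (a j : ℕ)) •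
        blockPow c (ConjClasses.mk (b j)) (a j)).prod : terwilligerAlgebra G) : Matrix G G ℂ) =
      vecChar ζ α a • if a = 0 then dualIdempotent c else blockTrans c K (vecPow b a) := by
  induction m with
  | zero =>
    rw [if_pos (Subsingleton.elim _ _)]
    simp [vecChar]
  | succ m ih =>
    have hmem : vecPow (fun j => b j.succ) (fun j => a j.succ) ∈ N := by
      refine Subgroup.list_prod_mem _ fun x hx => ?_
      obtain ⟨j, rfl⟩ := List.mem_ofFn.mp hx
      exact pow_mem (hbN _) _
    have ha : a = 0 ↔ (a 0 : ℕ) = 0 ∧ (fun j : Fin m => a j.succ) = 0 := by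
      constructor
      · rintro rfl
        exact ⟨rfl, rfl⟩
      · rintro ⟨h0, h1⟩
        funext j
        exact Fin.cases (Fin.ext h0) (fun j => congrFun h1 j) j
    have hchar : vecChar ζ α a = ζ ^ ((α 0 : ℕ) * (a 0 : ℕ)) *
        vecChar ζ (fun j => α j.succ) fun j => a j.succ := by
      rw [vecChar, Fin.prod_univ_succ]; rfl
    have hcE : ∀ n : ℕ, (if n = 0 then dualIdempotent c else blockTrans c K (b 0 ^ n)) =
        (if n = 0 then dualIdempotent c else blockTrans c K (b 0 ^ n)) * dualIdempotent c := by
      intro n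
      split_ifs
      · exact dualIdempotent_mul_self.symm
      · exact (blockTrans_mul_dualIdempotent _).symm
    rw [List.ofFn_succ, List.prod_cons, MulMemClass.coe_mul, smul_blockPow hKN hc (hbN 0) (hb 0),
      hcE, ← smul_mul_assoc, mul_assoc, ih (fun j => b j.succ) (fun j => hbN _)
        (fun j => hb _) (fun j => α j.succ) (fun j => a j.succ), smul_mul_smul_comm, mul_smul_comm,
      ← hchar, vecPow_succ]
    congr 1
    by_cases h0 : (a 0 : ℕ) = 0
    · rw [if_pos h0, h0, pow_zero, one_mul]
      by_cases h1 : (fun j : Fin m => a j.succ) = 0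
      · rw [if_pos h1, if_pos (ha.mpr ⟨h0, h1⟩), dualIdempotent_mul_self, dualIdempotent_mul_self]
      · rw [if_neg h1, if_neg (fun h => h1 (ha.mp h).2), dualIdempotent_mul_blockTrans,
          dualIdempotent_mul_blockTrans]
    · rw [if_neg h0, if_neg (fun h => h0 (ha.mp h).1)]
      by_cases h1 : (fun j : Fin m => a j.succ) = 0
      · rw [if_pos h1, blockTrans_mul_dualIdempotent, dualIdempotent_mul_blockTrans, h1, vecPow_zero,
          mul_one]
      · rw [if_neg h1, blockTrans_mul hKN hc (pow_mem (hbN 0) _)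
          (hcomm _ (pow_mem (hbN 0) _) _ hmem), dualIdempotent_mul_blockTrans]

/-- An empty product would be 1 instead of E_c^*, hence m ≠ 0: the first factor then absorbs the
extra E_c^* on the left. -/
theorem prod_blockPow (hKN : K ≤ N)
    (hc : ∀ u ∈ N, ∀ x, ConjClasses.mk x = c → ConjClasses.mk (u * x) = c)
    (hcomm : ∀ u ∈ N, ∀ v ∈ N, (u * v : G ⧸ K) = v * u) {p m : ℕ} [NeZero p] (hm : m ≠ 0)
    (b : Fin m → G) (hbN : ∀ j, b j ∈ N)
    (hb : ∀ j v, ConjClasses.mk v = ConjClasses.mk (b j) ↔ (b j : G ⧸ K) = v) (ζ : ℂ)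
    (α a : Fin m → Fin p) :
    (((List.ofFn fun j : Fin m =>
      (ζ ^ ((α j : ℕ) * (a j : ℕ)) / (Nat.card K : ℂ) ^ (a j : ℕ)) •
        blockPow c (ConjClasses.mk (b j)) (a j)).prod : terwilligerAlgebra G) : Matrix G G ℂ) =
      vecChar ζ α a • if a = 0 then dualIdempotent c else blockTrans c K (vecPow b a) := by
  rw [← dualIdempotent_mul_prod_blockPow hKN hc hcomm b hbN hb]
  obtain ⟨m, rfl⟩ := Nat.exists_eq_succ_of_ne_zero hm
  rw [List.ofFn_succ, List.prod_cons, MulMemClass.coe_mul, smul_blockPow hKN hc (hbN 0) (hb 0),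
    ← mul_assoc, mul_smul_comm, mul_ite, dualIdempotent_mul_self, dualIdempotent_mul_blockTrans]

end BlockTranslations

/-! ### The defining sums as character kernels -/

section Links

open scoped Classical

variable {G : Type*} [Group G] [Fintype G] [DecidableEq G] {c : ConjClasses G} {p : ℕ} [NeZero p]

/-- The case K = 1: block translations by central elements multiply exactly, and the sum over
exponents is the expansion of the character α of Z(G). -/
theorem coe_centralElt {k : ℕ} (hk : k ≠ 0) (z : Fin k → G) (hz : ∀ j, z j ∈ Subgroup.center G)
    (hc : ∀ u ∈ Subgroup.center G, ∀ x, ConjClasses.mk x = c → ConjClasses.mk (u * x) = c)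
    (hcard : Nat.card (Subgroup.center G) = p ^ k) (ζ : ℂ) (α : Fin k → Fin p) :
    (centralElt p ζ z c α : Matrix G G ℂ) =
      (Nat.card (Subgroup.center G) : ℂ)⁻¹ • classKernel c (charFun ⊥ z ζ α) := by
  have hprod : ∀ a : Fin k → Fin p, (((List.ofFn fun j : Fin k =>
      ζ ^ ((α j : ℕ) * (a j : ℕ)) • blockPow c (ConjClasses.mk (z j)) (a j)).prod :
        terwilligerAlgebra G) : Matrix G G ℂ) =
      vecChar ζ α a • blockTrans c ⊥ (vecPow z a) := by
    intro a
    have h := prod_blockPow (N := Subgroup.center G) (K := ⊥) (c := c) bot_le hc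
      (fun u _ v hv => congrArg _ (Subgroup.mem_center_iff.mp hv u)) hk z hz (fun j v => by
        rw [conjClasses_mk_eq_iff_of_mem_center (hz j), QuotientGroup.eq, Subgroup.mem_bot,
          inv_mul_eq_one, eq_comm]) ζ α a
    simp only [Subgroup.card_bot, Nat.cast_one, one_pow, div_one] at h
    rw [h]
    split_ifs with ha
    · rw [ha, vecPow_zero, blockTrans_bot_one]
    · rfl
  rw [centralElt, SetLike.val_smul, AddSubmonoidClass.coe_finsetSum]
  simp only [hprod]
  rw [sum_vecChar_smul_blockTrans, Subgroup.card_bot, hcard]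
  simp

/-- The case K = Z(G). The sum over Z(G) is p^k times the block translation by 1 and supplies the
term a = 0 of the character sum, where the product would give E_s^* instead. The factor p^k cancels
1/|Z(G)|. -/
theorem coe_eltY {n k : ℕ} (hn : n ≠ 0) (g : Fin n → G) (s : OuterClass G)
    (hg : ∀ j, g j ∈ commutator G)
    (hc : ∀ u ∈ commutator G, ∀ x, ConjClasses.mk x = s.1 → ConjClasses.mk (u * x) = s.1)
    (hZ : Subgroup.center G ≤ commutator G)
    (hcomm : ∀ u ∈ commutator G, ∀ v ∈ commutator G,
      (u * v : G ⧸ Subgroup.center G) = v * u)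
    (hb : ∀ j v, ConjClasses.mk v = ConjClasses.mk (g j) ↔ (g j : G ⧸ Subgroup.center G) = v)
    (hcard : Nat.card (Subgroup.center G) = p ^ k)
    (hcard' : Nat.card (commutator G) = p ^ (n + k)) (ζ : ℂ) (γ : Fin n → Fin p) :
    (eltY p k ζ g s γ : Matrix G G ℂ) =
      (Nat.card (commutator G) : ℂ)⁻¹ •
        classKernel s.1 (charFun (Subgroup.center G) g ζ γ) := by
  have hp0 : (p : ℂ) ≠ 0 := Nat.cast_ne_zero.mpr (NeZero.ne p)
  have hprod : ∀ a : Fin n → Fin p, a ≠ 0 → (((List.ofFn fun j : Fin n =>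
      (ζ ^ ((γ j : ℕ) * (a j : ℕ)) / (p : ℂ) ^ ((a j : ℕ) * k)) •
        blockPow s.1 (ConjClasses.mk (g j)) (a j)).prod : terwilligerAlgebra G) : Matrix G G ℂ) =
      vecChar ζ γ a • blockTrans s.1 (Subgroup.center G) (vecPow g a) := by
    intro a ha
    have h := prod_blockPow (c := s.1) hZ hc hcomm hn g hg hb ζ γ a
    rw [if_neg ha, hcard] at h
    rw [← h]
    simp only [Nat.cast_pow, ← pow_mul, mul_comm k]
  have hzero : ((∑ z : G with z ∈ Subgroup.center G, blockAdj s.1 (ConjClasses.mk z) :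
      terwilligerAlgebra G) : Matrix G G ℂ) =
      (p : ℂ) ^ k • (vecChar ζ γ 0 • blockTrans s.1 (Subgroup.center G)
        (vecPow g (0 : Fin n → Fin p))) := by
    rw [AddSubmonoidClass.coe_finsetSum, vecPow_zero, vecChar_zero, one_smul, blockTrans, hcard,
      smul_smul, Nat.cast_pow, mul_inv_cancel₀ (pow_ne_zero _ hp0), one_smul]
    simp only [coe_blockAdj]
    rw [sum_classKernel]
    congr 1
    funext v
    have h1 : ((1 : G) : G ⧸ Subgroup.center G) = v ↔ v ∈ Subgroup.center G := by
      rw [QuotientGroup.eq, inv_one, one_mul]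
    by_cases hv : v ∈ Subgroup.center G
    · rw [if_pos (h1.mpr hv), Finset.sum_eq_single v]
      · rw [if_pos rfl]
      · intro z hz hzv
        rw [if_neg]
        rw [conjClasses_mk_eq_iff_of_mem_center (Finset.mem_filter.mp hz).2]
        exact hzv.symm
      · intro h
        exact absurd (Finset.mem_filter.mpr ⟨Finset.mem_univ v, hv⟩) h
    · rw [if_neg (fun h => hv (h1.mp h)), Finset.sum_eq_zero]
      intro z hz
      rw [if_neg]
      rw [conjClasses_mk_eq_iff_of_mem_center (Finset.mem_filter.mp hz).2]
      rintro rfl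
      exact hv (Finset.mem_filter.mp hz).2
  have hfilter : (Finset.univ.filter fun a : Fin n → Fin p => ∃ j, (a j : ℕ) ≠ 0) =
      Finset.univ.erase 0 := by
    ext a
    rw [Finset.mem_filter, Finset.mem_erase, exists_fin_ne_zero_iff, and_comm]
  rw [eltY, SetLike.val_smul, AddMemClass.coe_add, hzero, AddSubmonoidClass.coe_finsetSum, hfilter]
  rw [Finset.sum_congr rfl (g := fun a : Fin n → Fin p => (p : ℂ) ^ k •
    (vecChar ζ γ a • blockTrans s.1 (Subgroup.center G) (vecPow g a)))]
  · rw [Finset.add_sum_erase _ (fun a : Fin n → Fin p => (p : ℂ) ^ k •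
      (vecChar ζ γ a • blockTrans s.1 (Subgroup.center G) (vecPow g a))) (Finset.mem_univ 0),
      ← Finset.smul_sum, sum_vecChar_smul_blockTrans, hcard, hcard', smul_smul, smul_smul]
    congr 1
    push_cast
    rw [mul_assoc, mul_inv_cancel₀ (pow_ne_zero _ hp0), mul_one, one_div]
  · intro a ha
    rw [SetLike.val_smul, hprod a (Finset.ne_of_mem_erase ha)]

end Links

/-! ### Counting classes that are cosets -/

section Classes

variable {G : Type*} [Group G]

theorem mk_mem_innerClass_iff {x : G} :
    (ConjClasses.mk x).carrier ⊆ (commutator G : Set G) \ (Subgroup.center G : Set G) ↔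
      x ∈ commutator G ∧ x ∉ Subgroup.center G := by
  constructor
  · exact fun h => h ConjClasses.mem_carrier_mk
  · rintro ⟨h1, h2⟩ y hy
    rw [ConjClasses.mem_carrier_iff_mk_eq, ConjClasses.mk_eq_mk_iff_isConj] at hy
    obtain ⟨g, rfl⟩ := isConj_iff.mp hy
    refine ⟨?_, fun h => h2 ((inferInstance : (Subgroup.center G).Normal).conj_mem _ h g)⟩
    have := (inferInstance : (commutator G).Normal).conj_mem _ h1 g⁻¹
    simpa [mul_assoc] using this

theorem mk_mem_outerClass_iff {x : G} :
    (ConjClasses.mk x).carrier ⊆ (commutator G : Set G)ᶜ ↔ x ∉ commutator G := by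
  constructor
  · exact fun h => h ConjClasses.mem_carrier_mk
  · intro h1 y hy hyc
    rw [ConjClasses.mem_carrier_iff_mk_eq, ConjClasses.mk_eq_mk_iff_isConj] at hy
    obtain ⟨g, rfl⟩ := isConj_iff.mp hy
    exact h1 ((inferInstance : (commutator G).Normal).conj_mem _ hyc g)

theorem mul_inv_mem_commutator_of_mk_eq {x y : G} (h : ConjClasses.mk x = ConjClasses.mk y) :
    y * x⁻¹ ∈ commutator G := by
  obtain ⟨g, rfl⟩ := isConj_iff.mp (ConjClasses.mk_eq_mk_iff_isConj.mp h)
  exact commutator_mem_commutator g x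

/-- If the classes in `U` are cosets of `M`, then `U` consists of `|U| / |M|` classes. -/
theorem card_classes_mul_card (P : ConjClasses G → Prop) (M : Subgroup G)
    (h1 : ∀ x, P (ConjClasses.mk x) → ∀ u ∈ M, ConjClasses.mk (u * x) = ConjClasses.mk x)
    (h2 : ∀ x y, P (ConjClasses.mk x) → ConjClasses.mk x = ConjClasses.mk y → y * x⁻¹ ∈ M) :
    Nat.card {c // P c} * Nat.card M = Nat.card {x : G // P (ConjClasses.mk x)} := by
  rw [← Nat.card_prod]
  have hout : ∀ c : ConjClasses G, ConjClasses.mk c.out = c := fun c => Quotient.out_eq _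
  have hmk : ∀ (c : {c // P c}) (u : M), ConjClasses.mk ((u : G) * c.1.out) = c.1 := by
    intro c u
    rw [h1 _ (by rw [hout]; exact c.2) _ u.2, hout]
  refine Nat.card_congr (Equiv.ofBijective
    (fun w => ⟨(w.2 : G) * w.1.1.out, by rw [hmk]; exact w.1.2⟩) ⟨?_, ?_⟩)
  · rintro ⟨c, u⟩ ⟨c', u'⟩ h
    have h' : (u : G) * c.1.out = u' * c'.1.out := congrArg Subtype.val h
    have hc : c = c' := Subtype.ext (by rw [← hmk c u, h', hmk])
    subst hc
    rw [mul_left_inj] at h'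
    rw [Subtype.ext h']
  · rintro ⟨x, hx⟩
    refine ⟨(⟨ConjClasses.mk x, hx⟩, ⟨x * (ConjClasses.mk x).out⁻¹,
      h2 _ _ (by rw [hout]; exact hx) (hout _)⟩), Subtype.ext ?_⟩
    simp

end Classes

/-! ### Recovering the class and the character from a kernel -/

section KernelInjectivity

open scoped Classical

variable {G : Type*} [Group G] {N N' : Subgroup G} {c c' : ConjClasses G} {f f' : G → ℂ} {r r' : ℂ}

theorem class_eq_of_smul_classKernel_eq (hf : IsKernelChar N f) (hr : r ≠ 0)
    (h : r • classKernel c f = r' • classKernel c' f') : c = c' := by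
  obtain ⟨x, rfl⟩ := ConjClasses.mk_surjective c
  by_contra hne
  have h1 := congrFun (congrFun h x) x
  rw [Matrix.smul_apply, Matrix.smul_apply, classKernel_apply, classKernel_apply,
    if_pos ⟨rfl, rfl⟩, if_neg (fun h' => hne h'.1), mul_inv_cancel, hf.one, smul_zero,
    smul_eq_mul, mul_one] at h1
  exact hr h1

theorem eq_of_smul_classKernel_eq
    (hc : ∀ u ∈ N, ∀ x, ConjClasses.mk x = c → ConjClasses.mk (u * x) = c)
    (h : r • classKernel c f = r' • classKernel c f') (v : G) (hv : v ∈ N) :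
    r * f v = r' * f' v := by
  obtain ⟨x, rfl⟩ := ConjClasses.mk_surjective c
  have h1 := congrFun (congrFun h x) (v * x)
  rwa [Matrix.smul_apply, Matrix.smul_apply, classKernel_apply, classKernel_apply,
    if_pos ⟨rfl, hc v hv x rfl⟩, if_pos ⟨rfl, hc v hv x rfl⟩, mul_inv_cancel_right] at h1

/-- At u the first kernel vanishes, while f' has no zeros on N'. This separates X from Y on the same
class. -/
theorem smul_classKernel_ne (hf : IsKernelChar N f) (hf' : IsKernelChar N' f') (hr : r' ≠ 0)
    (hc : ∀ u ∈ N', ∀ x, ConjClasses.mk x = c → ConjClasses.mk (u * x) = c)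
    {u : G} (hu : u ∉ N) (hu' : u ∈ N') : r • classKernel c f ≠ r' • classKernel c f' := by
  intro h
  have h1 := eq_of_smul_classKernel_eq hc h u hu'
  rw [hf.zero_of_notMem u hu, mul_zero] at h1
  have h2 := hf'.mul u hu' u⁻¹
  rw [mul_inv_cancel, hf'.one, (mul_eq_zero.mp h1.symm).resolve_left hr, zero_mul] at h2
  exact one_ne_zero h2

end KernelInjectivity

/-! ### The group-theoretic input -/

section Data

variable {G : Type*} [Group G] {p n k : ℕ} [Fact p.Prime] {ζ : ℂ} {z : Fin k → G} {g : Fin n → G}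

/-- A Camina `p`-group of class three with bases of its center and of `G' / Z(G)`. -/
structure IsCaminaData (p : ℕ) [Fact p.Prime] (ζ : ℂ) (z : Fin k → G) (g : Fin n → G) : Prop where
  finite : Finite G
  camina : IsClassThreeCamina p G
  root : IsPrimitiveRoot ζ p
  centralBasis : IsVecBasis p (Subgroup.center G) ⊥ z
  derivedBasis : IsVecBasis p (commutator G) (Subgroup.center G) g
  card_center : Nat.card (Subgroup.center G) = p ^ k
  card_commutator : Nat.card (commutator G) = p ^ (n + k)
  n_ne_zero : n ≠ 0
  k_ne_zero : k ≠ 0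

theorem IsClassThreeCamina.isCaminaData [Finite G] (h : IsClassThreeCamina p G)
    (hrel : (Subgroup.center G).relIndex (commutator G) = p ^ n)
    (hcenter : Nat.card (Subgroup.center G) = p ^ k)
    (hζ : IsPrimitiveRoot ζ p)
    (hz : Subgroup.closure (Set.range z) = Subgroup.center G)
    (hg : ∀ j, g j ∈ commutator G)
    (hgen : Subgroup.closure (Set.range fun j => (g j : G ⧸ Subgroup.center G)) =
      (commutator G).map (QuotientGroup.mk' (Subgroup.center G))) : IsCaminaData p ζ z g where
  finite := inferInstance
  camina := h
  root := hζ
  centralBasis := by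
    refine IsVecBasis.of_closure (Fact.out : p.Prime).one_lt bot_le
      (fun j => hz ▸ Subgroup.subset_closure ⟨j, rfl⟩) ?_
      (fun v hv => h.pow_eq_one_of_mem_center hv) ?_ ?_
    · exact fun u _ v hv => congrArg _ (Subgroup.mem_center_iff.mp hv u)
    · rw [← hz, MonoidHom.map_closure, ← Set.range_comp]
      rfl
    · rw [← Subgroup.relIndex_ker, QuotientGroup.ker_mk', Subgroup.relIndex_bot_left, hcenter]
  derivedBasis := by
    refine IsVecBasis.of_closure (Fact.out : p.Prime).one_lt h.center_le_commutator hg ?_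
      (fun v hv => h.pow_mem_center hv) hgen ?_
    · have := h.isMulCommutative
      exact fun u hu v hv => congrArg _ (commutator_comm_mem hu hv)
    · rw [← Subgroup.relIndex_ker, QuotientGroup.ker_mk', hrel]
  card_center := hcenter
  card_commutator := by
    rw [← Subgroup.card_mul_index ((Subgroup.center G).subgroupOf (commutator G)),
      Nat.card_congr (Subgroup.subgroupOfEquivOfLe h.center_le_commutator).toEquiv, hcenter,
      pow_add, mul_comm]
    exact congrArg (· * p ^ k) hrel
  n_ne_zero := by
    rintro rfl
    rw [pow_zero, Subgroup.relIndex_eq_one] at hrel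
    exact h.not_commutator_le_center hrel
  k_ne_zero := by
    rintro rfl
    rw [pow_zero, Subgroup.card_eq_one] at hcenter
    exact h.gammaThree_ne_bot (eq_bot_iff.mpr (hcenter ▸ h.gammaThree_le_center))

namespace IsCaminaData

theorem one_lt (_ : IsCaminaData p ζ z g) : 1 < p := (Fact.out : p.Prime).one_lt

theorem mk_mul_of_notMem_center (h : IsCaminaData p ζ z g) {v : G} (hv : v ∉ Subgroup.center G)
    {u : G} (hu : u ∈ Subgroup.center G) : ConjClasses.mk (u * v) = ConjClasses.mk v := by
  have := h.finite
  exact (ConjClasses.mk_eq_mk_iff_isConj.mpr (h.camina.isConj_mul_of_notMem_center hv hu)).symm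

theorem mk_mul_of_notMem_commutator (h : IsCaminaData p ζ z g) {v : G} (hv : v ∉ commutator G)
    {u : G} (hu : u ∈ commutator G) : ConjClasses.mk (u * v) = ConjClasses.mk v :=
  (ConjClasses.mk_eq_mk_iff_isConj.mpr (h.camina.isConj_mul_of_notMem_commutator hv hu)).symm

theorem center_mul_inner (h : IsCaminaData p ζ z g) (i : InnerClass G) :
    ∀ u ∈ Subgroup.center G, ∀ x, ConjClasses.mk x = i.1 → ConjClasses.mk (u * x) = i.1 := by
  rintro u hu x hx
  rw [← hx]
  refine h.mk_mul_of_notMem_center (mk_mem_innerClass_iff.mp ?_).2 hu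
  rw [hx]; exact i.2

theorem commutator_mul_outer (h : IsCaminaData p ζ z g) (s : OuterClass G) :
    ∀ u ∈ commutator G, ∀ x, ConjClasses.mk x = s.1 → ConjClasses.mk (u * x) = s.1 := by
  rintro u hu x hx
  rw [← hx]
  refine h.mk_mul_of_notMem_commutator (mk_mem_outerClass_iff.mp ?_) hu
  rw [hx]; exact s.2

theorem center_mul_outer (h : IsCaminaData p ζ z g) (s : OuterClass G) :
    ∀ u ∈ Subgroup.center G, ∀ x, ConjClasses.mk x = s.1 → ConjClasses.mk (u * x) = s.1 :=
  fun u hu => h.commutator_mul_outer s u (h.camina.center_le_commutator hu)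

theorem basis_notMem_center (h : IsCaminaData p ζ z g) (j : Fin n) :
    g j ∉ Subgroup.center G := by
  intro hj
  have h1 := h.derivedBasis.inj (Pi.single j 1) 0 (by
    rw [vecPow_single h.one_lt, vecPow_zero]
    exact (QuotientGroup.eq_one_iff _).mpr hj)
  have h2 := congrArg Fin.val (congrFun h1 j)
  rw [Pi.single_eq_same, Fin.val_one', Nat.mod_eq_of_lt h.one_lt] at h2
  exact one_ne_zero h2

theorem basis_mem (h : IsCaminaData p ζ z g) (j : Fin n) : g j ∈ commutator G := by
  rw [← vecPow_single h.one_lt g j]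
  exact h.derivedBasis.mem _

theorem center_basis_mem (h : IsCaminaData p ζ z g) (j : Fin k) : z j ∈ Subgroup.center G := by
  rw [← vecPow_single h.one_lt z j]
  exact h.centralBasis.mem _

theorem mk_eq_mk_basis_iff (h : IsCaminaData p ζ z g) (j : Fin n) (v : G) :
    ConjClasses.mk v = ConjClasses.mk (g j) ↔ (g j : G ⧸ Subgroup.center G) = v := by
  have := h.finite
  rw [QuotientGroup.eq]
  constructor
  · intro hv
    have h1 := h.camina.mul_inv_mem_center_of_isConj (h.basis_mem j)
      (ConjClasses.mk_eq_mk_iff_isConj.mp hv.symm)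
    have h2 := Subgroup.mem_center_iff.mp h1 (g j)⁻¹
    have h3 : (g j)⁻¹ * v = v * (g j)⁻¹ := by
      have h4 : (g j)⁻¹ * v * (g j)⁻¹ * g j = (v * (g j)⁻¹ * (g j)⁻¹) * g j := by
        rw [mul_assoc _ v, h2]
      simpa using h4
    rwa [h3]
  · intro hv
    have h1 := h.mk_mul_of_notMem_center (h.basis_notMem_center j) hv
    rw [← h1, ← Subgroup.mem_center_iff.mp hv (g j), mul_inv_cancel_left]

theorem exists_mem_commutator_notMem_center (h : IsCaminaData p ζ z g) :
    ∃ u ∈ commutator G, u ∉ Subgroup.center G :=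
  SetLike.not_le_iff_exists.mp h.camina.not_commutator_le_center

theorem card_innerClass (h : IsCaminaData p ζ z g) : Nat.card (InnerClass G) = p ^ n - 1 := by
  have := h.finite
  have h1 := card_classes_mul_card (G := G)
    (fun c => c.carrier ⊆ (commutator G : Set G) \ (Subgroup.center G : Set G))
    (Subgroup.center G)
    (fun x hx u hu => h.mk_mul_of_notMem_center (mk_mem_innerClass_iff.mp hx).2 hu)
    (fun x y hx hxy => h.camina.mul_inv_mem_center_of_isConj (mk_mem_innerClass_iff.mp hx).1
      (ConjClasses.mk_eq_mk_iff_isConj.mp hxy))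
  rw [Nat.card_congr (Equiv.subtypeEquivRight fun x => mk_mem_innerClass_iff)] at h1
  have h2 : Nat.card {x : G // x ∈ commutator G ∧ x ∉ Subgroup.center G} =
      p ^ (n + k) - p ^ k := by
    rw [← h.card_commutator, ← h.card_center]
    exact Set.ncard_sdiff (s := (Subgroup.center G : Set G)) (t := (commutator G : Set G))
      h.camina.center_le_commutator
  rw [h2, h.card_center, pow_add, ← Nat.sub_one_mul] at h1
  exact Nat.eq_of_mul_eq_mul_right (pow_pos (Fact.out : p.Prime).pos k) h1

theorem card_outerClass (h : IsCaminaData p ζ z g)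
    (hindex : (commutator G).index = p ^ (2 * n)) :
    Nat.card (OuterClass G) = p ^ (2 * n) - 1 := by
  have := h.finite
  have h1 := card_classes_mul_card (G := G) (fun c => c.carrier ⊆ (commutator G : Set G)ᶜ)
    (commutator G)
    (fun x hx u hu => h.mk_mul_of_notMem_commutator (mk_mem_outerClass_iff.mp hx) hu)
    (fun x y _ hxy => mul_inv_mem_commutator_of_mk_eq hxy)
  rw [Nat.card_congr (Equiv.subtypeEquivRight fun x => mk_mem_outerClass_iff)] at h1
  have h2 : Nat.card {x : G // x ∉ commutator G} = p ^ (2 * n) * Nat.card (commutator G) -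
      Nat.card (commutator G) := by
    rw [← hindex, Subgroup.index_mul_card]
    exact Set.ncard_compl (commutator G : Set G)
  rw [h2, ← Nat.sub_one_mul] at h1
  exact Nat.eq_of_mul_eq_mul_right Nat.card_pos h1

end IsCaminaData

end Data
-- The Wedderburn decomposition
section Decomposition

open scoped Classical

variable {G : Type*} [Group G] {p n k : ℕ} [Fact p.Prime] {ζ : ℂ} {z : Fin k → G} {g : Fin n → G}

namespace IsCaminaData

theorem isKernelChar_central (h : IsCaminaData p ζ z g) (α : NonzeroVector p k) :
    IsKernelChar (Subgroup.center G) (charFun ⊥ z ζ α.1) :=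
  h.centralBasis.isKernelChar h.root h.one_lt ((exists_fin_ne_zero_iff α.1).mp α.2)

theorem isKernelChar_derived (h : IsCaminaData p ζ z g) (γ : NonzeroVector p n) :
    IsKernelChar (commutator G) (charFun (Subgroup.center G) g ζ γ.1) :=
  h.derivedBasis.isKernelChar h.root h.one_lt ((exists_fin_ne_zero_iff γ.1).mp γ.2)

theorem inv_card_ne_zero [Finite G] (N : Subgroup G) : (Nat.card N : ℂ)⁻¹ ≠ 0 :=
  inv_ne_zero (Nat.cast_ne_zero.mpr Nat.card_pos.ne')

theorem inner_ne_outer (i : InnerClass G) (t : OuterClass G) : i.1 ≠ t.1 := by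
  intro hit
  obtain ⟨x, hx⟩ := ConjClasses.mk_surjective i.1
  have h1 : x ∈ commutator G := (mk_mem_innerClass_iff.mp (by rw [hx]; exact i.2)).1
  have h2 : x ∉ commutator G := mk_mem_outerClass_iff.mp (by rw [hx, hit]; exact t.2)
  exact h2 h1

/-- Fourier inversion on N/K: summing over all characters, the trivial one included, leaves the
indicator of K. -/
theorem sum_smul_classKernel_charFun {N K : Subgroup G} [K.Normal] {m : ℕ} {b : Fin m → G}
    (hB : IsVecBasis p N K b) (hζ : IsPrimitiveRoot ζ p) (c : ConjClasses G) (r : ℂ) :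
    ∑ α : Fin m → Fin p, r • classKernel c (charFun K b ζ α) =
      (r * (p : ℂ) ^ m) • classKernel c fun v => if v ∈ K then 1 else 0 := by
  rw [← Finset.smul_sum, sum_classKernel, smul_classKernel, smul_classKernel]
  congr 1
  funext v
  rw [hB.sum_charFun hζ (Fact.out : p.Prime).one_lt]
  split_ifs <;> ring

variable [Fintype G] [DecidableEq G]

theorem coe_centralElt_inner (h : IsCaminaData p ζ z g) (i : InnerClass G) (α : Fin k → Fin p) :
    (centralElt p ζ z i.1 α : Matrix G G ℂ) =
      (Nat.card (Subgroup.center G) : ℂ)⁻¹ • classKernel i.1 (charFun ⊥ z ζ α) :=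
  coe_centralElt h.k_ne_zero z h.center_basis_mem (h.center_mul_inner i) h.card_center ζ α

theorem coe_centralElt_outer (h : IsCaminaData p ζ z g) (t : OuterClass G) (β : Fin k → Fin p) :
    (centralElt p ζ z t.1 β : Matrix G G ℂ) =
      (Nat.card (Subgroup.center G) : ℂ)⁻¹ • classKernel t.1 (charFun ⊥ z ζ β) :=
  coe_centralElt h.k_ne_zero z h.center_basis_mem (h.center_mul_outer t) h.card_center ζ β

theorem coe_eltY (h : IsCaminaData p ζ z g) (s : OuterClass G) (γ : Fin n → Fin p) :
    (eltY p k ζ g s γ : Matrix G G ℂ) = (Nat.card (commutator G) : ℂ)⁻¹ •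
      classKernel s.1 (charFun (Subgroup.center G) g ζ γ) :=
  CaminaTerwilliger.coe_eltY h.n_ne_zero g s h.basis_mem (h.commutator_mul_outer s)
    h.camina.center_le_commutator h.derivedBasis.comm h.mk_eq_mk_basis_iff h.card_center
    h.card_commutator ζ γ

theorem isScalarIdempotent_eltW (h : IsCaminaData p ζ z g) (i : InnerClass G)
    (α : NonzeroVector p k) : IsScalarIdempotent (eltW p ζ z i α.1) :=
  (h.isKernelChar_central α).isScalarIdempotent (h.center_mul_inner i)
    (fun _ hv _ hu => h.mk_mul_of_notMem_center hv hu) (h.coe_centralElt_inner i α.1)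

theorem isScalarIdempotent_eltX (h : IsCaminaData p ζ z g) (t : OuterClass G)
    (β : NonzeroVector p k) : IsScalarIdempotent (eltX p ζ z t β.1) :=
  (h.isKernelChar_central β).isScalarIdempotent (h.center_mul_outer t)
    (fun _ hv _ hu => h.mk_mul_of_notMem_center hv hu) (h.coe_centralElt_outer t β.1)

theorem isScalarIdempotent_eltY (h : IsCaminaData p ζ z g) (s : OuterClass G)
    (γ : NonzeroVector p n) : IsScalarIdempotent (eltY p k ζ g s γ.1) :=
  (h.isKernelChar_derived γ).isScalarIdempotent (h.commutator_mul_outer s)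
    (fun _ hv _ hu => h.mk_mul_of_notMem_commutator hv hu) (h.coe_eltY s γ.1)

theorem eltW_injective (h : IsCaminaData p ζ z g) :
    Function.Injective fun c : InnerClass G × NonzeroVector p k => eltW p ζ z c.1 c.2.1 := by
  rintro ⟨i, α⟩ ⟨j, β⟩ heq
  have h1 := congrArg Subtype.val heq
  change (centralElt p ζ z i.1 α.1 : Matrix G G ℂ) = centralElt p ζ z j.1 β.1 at h1
  rw [h.coe_centralElt_inner, h.coe_centralElt_inner] at h1
  have hij : i = j := Subtype.ext (class_eq_of_smul_classKernel_eq (h.isKernelChar_central α)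
    (inv_card_ne_zero _) h1)
  subst hij
  have hαβ : α = β := Subtype.ext (h.centralBasis.charFun_injective h.root h.one_lt fun v hv =>
    mul_left_cancel₀ (inv_card_ne_zero _)
      (eq_of_smul_classKernel_eq (h.center_mul_inner i) h1 v hv))
  rw [hαβ]

theorem eltX_injective (h : IsCaminaData p ζ z g) :
    Function.Injective fun c : OuterClass G × NonzeroVector p k => eltX p ζ z c.1 c.2.1 := by
  rintro ⟨i, α⟩ ⟨j, β⟩ heq
  have h1 := congrArg Subtype.val heq
  change (centralElt p ζ z i.1 α.1 : Matrix G G ℂ) = centralElt p ζ z j.1 β.1 at h1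
  rw [h.coe_centralElt_outer, h.coe_centralElt_outer] at h1
  have hij : i = j := Subtype.ext (class_eq_of_smul_classKernel_eq (h.isKernelChar_central α)
    (inv_card_ne_zero _) h1)
  subst hij
  have hαβ : α = β := Subtype.ext (h.centralBasis.charFun_injective h.root h.one_lt fun v hv =>
    mul_left_cancel₀ (inv_card_ne_zero _)
      (eq_of_smul_classKernel_eq (h.center_mul_outer i) h1 v hv))
  rw [hαβ]

theorem eltY_injective (h : IsCaminaData p ζ z g) :
    Function.Injective fun c : OuterClass G × NonzeroVector p n => eltY p k ζ g c.1 c.2.1 := by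
  rintro ⟨i, α⟩ ⟨j, β⟩ heq
  have h1 := congrArg Subtype.val heq
  change (eltY p k ζ g i α.1 : Matrix G G ℂ) = eltY p k ζ g j β.1 at h1
  rw [h.coe_eltY, h.coe_eltY] at h1
  have hij : i = j := Subtype.ext (class_eq_of_smul_classKernel_eq (h.isKernelChar_derived α)
    (inv_card_ne_zero _) h1)
  subst hij
  have hαβ : α = β := Subtype.ext (h.derivedBasis.charFun_injective h.root h.one_lt fun v hv =>
    mul_left_cancel₀ (inv_card_ne_zero _)
      (eq_of_smul_classKernel_eq (h.commutator_mul_outer i) h1 v hv))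
  rw [hαβ]

theorem eltW_ne_eltX (h : IsCaminaData p ζ z g) (i : InnerClass G) (α : NonzeroVector p k)
    (t : OuterClass G) (β : NonzeroVector p k) : eltW p ζ z i α.1 ≠ eltX p ζ z t β.1 := by
  intro heq
  have h1 := congrArg Subtype.val heq
  change (centralElt p ζ z i.1 α.1 : Matrix G G ℂ) = centralElt p ζ z t.1 β.1 at h1
  rw [h.coe_centralElt_inner, h.coe_centralElt_outer] at h1
  exact inner_ne_outer i t (class_eq_of_smul_classKernel_eq (h.isKernelChar_central α)
    (inv_card_ne_zero _) h1)

theorem eltW_ne_eltY (h : IsCaminaData p ζ z g) (i : InnerClass G) (α : NonzeroVector p k)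
    (s : OuterClass G) (γ : NonzeroVector p n) : eltW p ζ z i α.1 ≠ eltY p k ζ g s γ.1 := by
  intro heq
  have h1 := congrArg Subtype.val heq
  change (centralElt p ζ z i.1 α.1 : Matrix G G ℂ) = eltY p k ζ g s γ.1 at h1
  rw [h.coe_centralElt_inner, h.coe_eltY] at h1
  exact inner_ne_outer i s (class_eq_of_smul_classKernel_eq (h.isKernelChar_central α)
    (inv_card_ne_zero _) h1)

theorem eltX_ne_eltY (h : IsCaminaData p ζ z g) (t : OuterClass G) (β : NonzeroVector p k)
    (s : OuterClass G) (γ : NonzeroVector p n) : eltX p ζ z t β.1 ≠ eltY p k ζ g s γ.1 := by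
  intro heq
  have h1 := congrArg Subtype.val heq
  change (centralElt p ζ z t.1 β.1 : Matrix G G ℂ) = eltY p k ζ g s γ.1 at h1
  rw [h.coe_centralElt_outer, h.coe_eltY] at h1
  have hts : t = s := Subtype.ext (class_eq_of_smul_classKernel_eq (h.isKernelChar_central β)
    (inv_card_ne_zero _) h1)
  subst hts
  obtain ⟨u, hu, hu'⟩ := h.exists_mem_commutator_notMem_center
  exact smul_classKernel_ne (h.isKernelChar_central β) (h.isKernelChar_derived γ)
    (inv_card_ne_zero _) (h.commutator_mul_outer t) hu' hu h1

/-- The central idempotents that generate the components. -/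
noncomputable def componentIdem (p : ℕ) {n k : ℕ} (ζ : ℂ) (z : Fin k → G) (g : Fin n → G) :
    ComponentIndex G p n k → terwilligerAlgebra G
  | .primary => primaryIdem G
  | .first i α => eltW p ζ z i α.1
  | .second t β => eltX p ζ z t β.1
  | .third s γ => eltY p k ζ g s γ.1

theorem componentIdem_injective (h : IsCaminaData p ζ z g) {c c' : ComponentIndex G p n k}
    (hc : c ≠ .primary) (hc' : c' ≠ .primary)
    (heq : componentIdem p ζ z g c = componentIdem p ζ z g c') : c = c' := by
  rcases c with _ | ⟨i, α⟩ | ⟨t, β⟩ | ⟨s, γ⟩ <;> rcases c' with _ | ⟨i', α'⟩ | ⟨t', β'⟩ | ⟨s', γ'⟩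
  any_goals exact absurd rfl hc
  any_goals exact absurd rfl hc'
  · have := h.eltW_injective (a₁ := (i, α)) (a₂ := (i', α')) heq
    rw [Prod.mk.injEq] at this
    rw [this.1, this.2]
  · exact absurd heq (h.eltW_ne_eltX _ _ _ _)
  · exact absurd heq (h.eltW_ne_eltY _ _ _ _)
  · exact absurd heq.symm (h.eltW_ne_eltX _ _ _ _)
  · have := h.eltX_injective (a₁ := (t, β)) (a₂ := (t', β')) heq
    rw [Prod.mk.injEq] at this
    rw [this.1, this.2]
  · exact absurd heq (h.eltX_ne_eltY _ _ _ _)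
  · exact absurd heq.symm (h.eltW_ne_eltY _ _ _ _)
  · exact absurd heq.symm (h.eltX_ne_eltY _ _ _ _)
  · have := h.eltY_injective (a₁ := (s, γ)) (a₂ := (s', γ')) heq
    rw [Prod.mk.injEq] at this
    rw [this.1, this.2]

theorem isScalarIdempotent_componentIdem (h : IsCaminaData p ζ z g) {c : ComponentIndex G p n k}
    (hc : c ≠ .primary) : IsScalarIdempotent (componentIdem p ζ z g c) := by
  rcases c with _ | ⟨i, α⟩ | ⟨t, β⟩ | ⟨s, γ⟩
  · exact absurd rfl hc
  · exact h.isScalarIdempotent_eltW i α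
  · exact h.isScalarIdempotent_eltX t β
  · exact h.isScalarIdempotent_eltY s γ

theorem component_eq_idealGen {c : ComponentIndex G p n k} (hc : c ≠ .primary) :
    component p ζ z g c = idealGen (componentIdem p ζ z g c) := by
  rcases c with _ | _ | _ | _
  · exact absurd rfl hc
  all_goals rfl

theorem componentIdem_mul_primaryIdem (h : IsCaminaData p ζ z g) {c : ComponentIndex G p n k}
    (hc : c ≠ .primary) : componentIdem p ζ z g c * primaryIdem G = 0 := by
  rcases c with _ | ⟨i, α⟩ | ⟨t, β⟩ | ⟨s, γ⟩
  · exact absurd rfl hc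
  · exact (h.isKernelChar_central α).mul_primaryIdem (h.center_mul_inner i)
      (h.coe_centralElt_inner i α.1)
  · exact (h.isKernelChar_central β).mul_primaryIdem (h.center_mul_outer t)
      (h.coe_centralElt_outer t β.1)
  · exact (h.isKernelChar_derived γ).mul_primaryIdem (h.commutator_mul_outer s) (h.coe_eltY s γ.1)

theorem isMinimalTwoSided_component (h : IsCaminaData p ζ z g) (c : ComponentIndex G p n k) :
    IsMinimalTwoSided (component p ζ z g c) := by
  by_cases hc : c = .primary
  · subst hc
    exact isMinimalTwoSided_primaryComponent
  · rw [component_eq_idealGen hc]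
    exact (h.isScalarIdempotent_componentIdem hc).isMinimalTwoSided

theorem mul_componentIdem_self (h : IsCaminaData p ζ z g) (c : ComponentIndex G p n k)
    (x : terwilligerAlgebra G) (hx : x ∈ component p ζ z g c) :
    x * componentIdem p ζ z g c = x := by
  by_cases hc : c = .primary
  · subst hc
    exact mem_primaryComponent.mp hx
  · rw [component_eq_idealGen hc] at hx
    obtain ⟨r, rfl⟩ := (h.isScalarIdempotent_componentIdem hc).mem_idealGen.mp hx
    rw [smul_mul_assoc, (h.isScalarIdempotent_componentIdem hc).idem.eq]

theorem mul_componentIdem_of_ne (h : IsCaminaData p ζ z g) (c c' : ComponentIndex G p n k)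
    (hne : c' ≠ c) (x : terwilligerAlgebra G) (hx : x ∈ component p ζ z g c') :
    x * componentIdem p ζ z g c = 0 := by
  by_cases hc' : c' = .primary
  · subst hc'
    rw [← mem_primaryComponent.mp hx, mul_assoc, primaryIdem_comm,
      h.componentIdem_mul_primaryIdem hne.symm, mul_zero]
  · rw [component_eq_idealGen hc'] at hx
    obtain ⟨r, rfl⟩ := (h.isScalarIdempotent_componentIdem hc').mem_idealGen.mp hx
    rw [smul_mul_assoc]
    by_cases hc : c = .primary
    · subst hc
      exact (congrArg (r • ·) (h.componentIdem_mul_primaryIdem hc')).trans (smul_zero _)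
    · rw [(h.isScalarIdempotent_componentIdem hc').mul_eq_zero_of_ne
        (h.isScalarIdempotent_componentIdem hc)
        (fun heq => hne (h.componentIdem_injective hc' hc heq)), smul_zero]

/-- The kernel of the trivial character is constant on the block. -/
theorem mem_primaryComponent_of_charFun_zero {N K : Subgroup G} [K.Normal] {m : ℕ} {b : Fin m → G}
    (hB : IsVecBasis p N K b) {c : ConjClasses G}
    (hN : ∀ x y, ConjClasses.mk x = c → ConjClasses.mk y = c → y * x⁻¹ ∈ N) (r : ℂ)
    {e : terwilligerAlgebra G}
    (he : (e : Matrix G G ℂ) = r • classKernel c (charFun K b ζ (0 : Fin m → Fin p))) :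
    e ∈ primaryComponent G := by
  refine mem_primaryComponent.mpr (mul_primaryIdem_of_class _ fun x y w => ?_)
  rw [he, Matrix.smul_apply, Matrix.smul_apply, classKernel_apply, classKernel_apply,
    conjClasses_mk_conj]
  by_cases hxy : ConjClasses.mk x = c ∧ ConjClasses.mk y = c
  · rw [if_pos hxy, if_pos hxy, hB.charFun_zero (hN _ _ hxy.1 hxy.2),
      hB.charFun_zero (hN _ _ hxy.1 (by rw [conjClasses_mk_conj]; exact hxy.2))]
  · rw [if_neg hxy, if_neg hxy]

theorem classKernel_bot (c : ConjClasses G) :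
    classKernel c (fun v => if v ∈ (⊥ : Subgroup G) then 1 else 0) = dualIdempotent c := by
  ext x y
  rw [dualIdempotent_eq, classKernel_apply, diagonal_apply]
  by_cases hxy : x = y
  · subst hxy; simp
  · have : ¬ y * x⁻¹ = 1 := fun h => hxy (mul_inv_eq_one.mp h).symm
    simp [hxy, this]

theorem sum_centralElt (h : IsCaminaData p ζ z g) (c : ConjClasses G)
    (hc : ∀ u ∈ Subgroup.center G, ∀ x, ConjClasses.mk x = c → ConjClasses.mk (u * x) = c) :
    ∑ α, centralElt p ζ z c α = dualT c := by
  refine Subtype.ext ?_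
  have hp0 : (p : ℂ) ≠ 0 := Nat.cast_ne_zero.mpr (NeZero.ne p)
  rw [AddSubmonoidClass.coe_finsetSum]
  simp only [coe_centralElt h.k_ne_zero z h.center_basis_mem hc h.card_center]
  rw [sum_smul_classKernel_charFun h.centralBasis h.root, h.card_center, Nat.cast_pow,
    inv_mul_cancel₀ (pow_ne_zero _ hp0), one_smul, classKernel_bot]
  rfl

/-- Both sides are the normalized indicator kernel of Z(G): on the left by summing the characters of
G' trivial on Z(G), on the right as the trivial character of Z(G). -/
theorem sum_eltY (h : IsCaminaData p ζ z g) (s : OuterClass G) :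
    ∑ γ, eltY p k ζ g s γ = centralElt p ζ z s.1 0 := by
  refine Subtype.ext ?_
  have hp0 : (p : ℂ) ≠ 0 := Nat.cast_ne_zero.mpr (NeZero.ne p)
  rw [AddSubmonoidClass.coe_finsetSum, h.coe_centralElt_outer]
  simp only [h.coe_eltY]
  rw [sum_smul_classKernel_charFun h.derivedBasis h.root, h.card_commutator, h.card_center]
  have h1 : charFun ⊥ z ζ (0 : Fin k → Fin p) =
      fun v => if v ∈ Subgroup.center G then (1 : ℂ) else 0 := by
    funext v
    split_ifs with hv
    · exact h.centralBasis.charFun_zero hv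
    · exact h.centralBasis.charFun_of_notMem hv
  rw [h1]
  have h2 : (((p ^ (n + k) : ℕ) : ℂ)⁻¹ * (p : ℂ) ^ n) = ((p ^ k : ℕ) : ℂ)⁻¹ := by
    push_cast
    rw [pow_add]
    field_simp
  rw [h2]
  refine congrArg _ (congrArg _ (funext fun v => ?_))
  split_ifs <;> rfl

/-- Nontrivial characters contribute generators of components. The remaining terms are constant on
blocks and fall into V, because a central class is a point, an inner class one Z(G)-coset and an
outer class one G'-coset; on an outer class X(0) must first be split into the Y(γ). -/
theorem dualT_mem (h : IsCaminaData p ζ z g) (c : ConjClasses G) :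
    dualT c ∈ ⨆ i : ComponentIndex G p n k, component p ζ z g i := by
  have hprim : primaryComponent G ≤ ⨆ i : ComponentIndex G p n k, component p ζ z g i :=
    le_iSup (component p ζ z g) .primary
  have hcomp : ∀ i : ComponentIndex G p n k, i ≠ .primary →
      componentIdem p ζ z g i ∈ ⨆ i : ComponentIndex G p n k, component p ζ z g i := by
    intro i hi
    refine le_iSup (component p ζ z g) i ?_
    rw [component_eq_idealGen hi]
    exact (h.isScalarIdempotent_componentIdem hi).self_mem_idealGen
  obtain ⟨x, rfl⟩ := ConjClasses.mk_surjective c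
  by_cases hx : x ∈ commutator G
  · by_cases hxZ : x ∈ Subgroup.center G
    · refine hprim (mem_primaryComponent.mpr (mul_primaryIdem_of_class _ fun w y q => ?_))
      change dualIdempotent _ _ _ = dualIdempotent _ _ _
      rw [dualIdempotent_eq, diagonal_apply, diagonal_apply]
      by_cases hw : w = x
      · subst hw
        have : w = q * y * q⁻¹ ↔ w = y := by
          rw [eq_mul_inv_iff_mul_eq, ← Subgroup.mem_center_iff.mp hxZ q, mul_right_inj]
        simp only [this]
      · have : ¬ ConjClasses.mk w = ConjClasses.mk x := fun h' =>
          hw ((conjClasses_mk_eq_iff_of_mem_center hxZ).mp h')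
        simp only [if_neg this, ite_self]
    · let i : InnerClass G := ⟨ConjClasses.mk x, mk_mem_innerClass_iff.mpr ⟨hx, hxZ⟩⟩
      rw [← h.sum_centralElt _ (h.center_mul_inner i)]
      refine Submodule.sum_mem _ fun α _ => ?_
      by_cases hα : α = 0
      · subst hα
        refine hprim (mem_primaryComponent_of_charFun_zero h.centralBasis (fun a b ha hb => ?_) _
          (h.coe_centralElt_inner i 0))
        have ha' := (mk_mem_innerClass_iff.mp (by rw [ha]; exact i.2)).1
        exact h.camina.mul_inv_mem_center_of_isConj ha'
          (ConjClasses.mk_eq_mk_iff_isConj.mp (ha.trans hb.symm))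
      · exact hcomp (.first i ⟨α, (exists_fin_ne_zero_iff α).mpr hα⟩) (by simp)
  · let s : OuterClass G := ⟨ConjClasses.mk x, mk_mem_outerClass_iff.mpr hx⟩
    rw [← h.sum_centralElt _ (h.center_mul_outer s)]
    refine Submodule.sum_mem _ fun β _ => ?_
    by_cases hβ : β = 0
    · subst hβ
      have hs : centralElt p ζ z (ConjClasses.mk x) 0 = ∑ γ, eltY p k ζ g s γ := (h.sum_eltY s).symm
      rw [hs]
      refine Submodule.sum_mem _ fun γ _ => ?_
      by_cases hγ : γ = 0
      · subst hγ
        exact hprim (mem_primaryComponent_of_charFun_zero h.derivedBasis (fun a b ha hb =>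
          mul_inv_mem_commutator_of_mk_eq (ha.trans hb.symm)) _ (h.coe_eltY s 0))
      · exact hcomp (.third s ⟨γ, (exists_fin_ne_zero_iff γ).mpr hγ⟩) (by simp)
    · exact hcomp (.second s ⟨β, (exists_fin_ne_zero_iff β).mpr hβ⟩) (by simp)

theorem isInternal_component (h : IsCaminaData p ζ z g) :
    DirectSum.IsInternal (component (n := n) (k := k) p ζ z g) := by
  refine isInternal_of_mul_idempotents _ (componentIdem p ζ z g) h.mul_componentIdem_self
    h.mul_componentIdem_of_ne ?_
  have h1 : (1 : terwilligerAlgebra G) = ∑ c, dualT c := by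
    refine terwilliger_ext fun x y => ?_
    rw [AddSubmonoidClass.coe_finsetSum, Matrix.sum_apply]
    simp only [dualT, dualIdempotent_eq, diagonal_apply]
    rw [OneMemClass.coe_one, Matrix.one_apply]
    split_ifs <;> simp
  rw [h1]
  exact Submodule.sum_mem _ fun c _ => h.dualT_mem c

end IsCaminaData

theorem ncard_range_idealGen {ι R : Type*} [Ring R] [Algebra ℂ R] {e : ι → R}
    (he : ∀ i, IsScalarIdempotent (e i)) (hinj : Function.Injective e) :
    (Set.range fun i => idealGen (e i)).ncard = Nat.card ι := by
  rw [← Nat.card_coe_set_eq, Nat.card_range_of_injective]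
  exact fun i j hij => hinj ((he i).eq_of_idealGen_eq (he j) hij)

end Decomposition

end CaminaTerwilliger

theorem mainTheorem1 {G : Type*} [Group G] [Fintype G] [DecidableEq G] [Group.IsNilpotent G]
    (p n k : ℕ) (hp : p.Prime) (hG : IsPGroup p G) (hCamina : IsCamina G)
    (hclass : Group.nilpotencyClass G = 3)
    (hindex : (commutator G).index = p ^ (2 * n))
    (hrel : (Subgroup.center G).relIndex (commutator G) = p ^ n)
    (hcenter : Nat.card (Subgroup.center G) = p ^ k)
    (ζ : ℂ) (hζ : IsPrimitiveRoot ζ p)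
    (z : Fin k → G) (hz : Subgroup.closure (Set.range z) = Subgroup.center G)
    (g : Fin n → G) (hg : ∀ j, g j ∈ commutator G)
    (hgen : Subgroup.closure (Set.range fun j => (g j : G ⧸ Subgroup.center G)) =
      (commutator G).map (QuotientGroup.mk' (Subgroup.center G))) :
    -- the generators are idempotents
    (∀ (i : InnerClass G) (α : NonzeroVector p k), IsIdempotentElem (eltW p ζ z i α.1)) ∧
    (∀ (t : OuterClass G) (β : NonzeroVector p k), IsIdempotentElem (eltX p ζ z t β.1)) ∧
    (∀ (s : OuterClass G) (γ : NonzeroVector p n), IsIdempotentElem (eltY p k ζ g s γ.1)) ∧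
    -- the ideals they generate are one-dimensional
    (∀ (i : InnerClass G) (α : NonzeroVector p k),
      Module.finrank ℂ ((idealGen (eltW p ζ z i α.1)).restrictScalars ℂ) = 1) ∧
    (∀ (t : OuterClass G) (β : NonzeroVector p k),
      Module.finrank ℂ ((idealGen (eltX p ζ z t β.1)).restrictScalars ℂ) = 1) ∧
    (∀ (s : OuterClass G) (γ : NonzeroVector p n),
      Module.finrank ℂ ((idealGen (eltY p k ζ g s γ.1)).restrictScalars ℂ) = 1) ∧
    -- `T(G)` is the direct sum of the minimal two-sided ideals `V`, `(W)`, `(X)`, `(Y)`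
    (∀ c : ComponentIndex G p n k, IsMinimalTwoSided (component p ζ z g c)) ∧
    DirectSum.IsInternal (component p ζ z g) ∧
    -- the number of classes in `G' \ Z(G)` and in `G \ G'`
    Nat.card (InnerClass G) = p ^ n - 1 ∧
    Nat.card (OuterClass G) = p ^ (2 * n) - 1 ∧
    -- the number of ideals of each kind
    (Set.range fun c : InnerClass G × NonzeroVector p k =>
      idealGen (eltW p ζ z c.1 c.2.1)).ncard = (p ^ n - 1) * (p ^ k - 1) ∧
    (Set.range fun c : OuterClass G × NonzeroVector p k =>
      idealGen (eltX p ζ z c.1 c.2.1)).ncard = (p ^ (2 * n) - 1) * (p ^ k - 1) ∧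
    (Set.range fun c : OuterClass G × NonzeroVector p n =>
      idealGen (eltY p k ζ g c.1 c.2.1)).ncard = (p ^ (2 * n) - 1) * (p ^ n - 1) := by
  have hfact : Fact p.Prime := ⟨hp⟩
  have h := (IsClassThreeCamina.of_isCamina hG hCamina hclass).isCaminaData hrel hcenter hζ hz hg hgen
  have hW := fun c : InnerClass G × NonzeroVector p k => h.isScalarIdempotent_eltW c.1 c.2
  have hX := fun c : OuterClass G × NonzeroVector p k => h.isScalarIdempotent_eltX c.1 c.2
  have hY := fun c : OuterClass G × NonzeroVector p n => h.isScalarIdempotent_eltY c.1 c.2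
  have hI : Nat.card (InnerClass G) = p ^ n - 1 := h.card_innerClass
  have hO : Nat.card (OuterClass G) = p ^ (2 * n) - 1 := h.card_outerClass hindex
  refine ⟨fun i α => (hW (i, α)).idem, fun t β => (hX (t, β)).idem, fun s γ => (hY (s, γ)).idem,
    ?_, ?_, ?_, h.isMinimalTwoSided_component, h.isInternal_component, hI, hO, ?_, ?_, ?_⟩
  · intro i α
    exact (hW (i, α)).finrank_idealGen
  · intro t β
    exact (hX (t, β)).finrank_idealGen
  · intro s γ
    exact (hY (s, γ)).finrank_idealGen
  · rw [ncard_range_idealGen hW h.eltW_injective, Nat.card_prod, hI, card_nonzeroVector]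
  · rw [ncard_range_idealGen hX h.eltX_injective, Nat.card_prod, hO, card_nonzeroVector]
  · rw [ncard_range_idealGen hY h.eltY_injective, Nat.card_prod, hO, card_nonzeroVector]
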